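/- Let $q\ge 2$, $a_1,\dots,a_q\in\mathbb R$, $\sigma_1,\dots,\sigma_q\ge 0$, and let $\eta_{in}$ ($1\le i\le q$, $n\ge 1$) be random variables on a probability space with $\mathbf E\eta_{i1}=0$ and $\mathbf E\eta_{i1}^2=1$. Put $\alpha_{in}=a_i+\sigma_i\eta_{in}$, and let $A_n$ be the $q\times q$ matrix with first row $(\alpha_{1n},\dots,\alpha_{qn})$ and with $(I_{q-1}\;\;0)$ below it. Assume: (D1) the $\eta_{in}$ are i.i.d. with a symmetric, continuous, positive density $\phi$ that is nonincreasing on $[0,\infty)$, and they have moments of all orders; (D2) $\mathbf E(\alpha_{11}-a_1)^{2m}\in(1,\infty)$ for some $m\in\mathbb N$; and $a_q^2+\sigma_q^2>0$. Let $|\cdot|$ be the Euclidean norm, or the Frobenius norm for matrices, let $S=\{z\in\mathbb R^q:|z|=1\}$, let $\Lambda$ be Lebesgue (surface) measure on $S$, and for $x\in S$ let $x_0=x$, $x_n'=x_{n-1}'A_n/|x_{n-1}'A_n|$. This is well defined almost surely. 1. Under $\mathbf P$, the process $(x_n)_{n\ge 0}$ is a Markov chain on $S$ with transition kernel $K(x,B)=\mathbf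 P\big(x'A_1/|x'A_1|\in B\big)$. It is positive Harris recurrent, and it is uniformly geometrically ergodic: there are an invariant probability measure $\pi$ and constants $C$ and $r\in[0,1)$ such that $\sup_{x\in S}\|\mathbf P_x(x_n\in\cdot)-\pi\|\le Cr^n$ for all $n\ge 0$, where $\|\cdot\|$ is the total variation norm. The measure $\pi$ is equivalent to $\Lambda$. 2. Let $\lambda>0$ be such that $\kappa(\lambda):=\lim_{n\to\infty}(\mathbf E|A_1\cdots A_n|^\lambda)^{1/n}=1$, and let $h:S\to(0,\infty)$ be continuous with $\mathbf E\,|x'A_1|^\lambda h\big(x'A_1/|x'A_1|\big)=h(x)$ for all $x\in S$. Let $\tilde{\mathbf P}_x$ be the tilted law, that is, the law under which the path starts at $x$ and, for all $n$ and all measurable $F\ge 0$, $$\tilde{\mathbf E}_xF(x_1,\dots,x_n)=\frac1{h(x)}\,\mathbf E\big[|x'A_1\cdots A_n|^\lambda\, h(x_n)\,F(x_1,\dots,x_n)\big].$$ It is the law of the Markov chain on $S$ with transition kernel $\tilde K(x,B)=h(x)^{-1}\,\mathbf E\big[|x'A_1|^\lambda h(x_1)\mathbf 1_{\{x_1\in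 B\}}\big]$. This chain is also positive Harris recurrent and uniformly geometrically ergodic in the same sense, with an invariant probability measure $\tilde\pi$ that is equivalent to $\Lambda$. -/

import Mathlib

open MeasureTheory ProbabilityTheory Filter Topology
open scoped ENNReal

/-! ### Markov chains on a general state space -/

section MarkovChains

variable {S : Type*} [MeasurableSpace S]

/-- The law on path space `ℕ → S` of the time-homogeneous Markov chain with transition kernel `K`
started at `x` (constructed by the Ionescu-Tulcea theorem). -/
noncomputable def chainLaw (K : Kernel S S) [IsMarkovKernel K] (x : S) : Measure (ℕ → S) :=
  Kernel.traj (X := fun _ => S)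
    (fun n => K.comap (fun w : (i : Finset.Iic n) → S => w ⟨n, Finset.mem_Iic.2 le_rfl⟩)
      (measurable_pi_apply _)) 0 (fun _ => x)

/-- Harris recurrence: there is a nonzero σ-finite measure `ψ` such that, from every starting point,
the chain almost surely visits every `ψ`-positive measurable set infinitely often. -/
def IsHarrisRecurrent (K : Kernel S S) [IsMarkovKernel K] : Prop :=
  ∃ ψ : Measure S, SigmaFinite ψ ∧ ψ ≠ 0 ∧
    ∀ A : Set S, MeasurableSet A → 0 < ψ A →
      ∀ x : S, ∀ᵐ w ∂(chainLaw K x), ∃ᶠ n in atTop, w n ∈ A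

/-- Positive Harris recurrence: Harris recurrence together with an invariant probability
measure. -/
def IsPositiveHarrisRecurrent (K : Kernel S S) [IsMarkovKernel K] : Prop :=
  IsHarrisRecurrent K ∧ ∃ π : Measure S, IsProbabilityMeasure π ∧ Kernel.Invariant K π

/-- Total variation norm of `μ - ν`, i.e. the supremum of `|∫ f dμ - ∫ f dν|` over measurable
functions `f` with `|f| ≤ 1`. -/
noncomputable def tvDist (μ ν : Measure S) : ℝ≥0∞ :=
  ⨆ (f : S → ℝ) (_ : Measurable f) (_ : ∀ x, |f x| ≤ 1),
    ENNReal.ofReal |(∫ x, f x ∂μ) - ∫ x, f x ∂ν|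

/-- Uniform geometric ergodicity with limit `π`: the `n`-step transition probabilities converge to
`π` in total variation at a geometric rate, uniformly in the starting point. -/
def IsUniformlyGeometricallyErgodic (K : Kernel S S) [IsMarkovKernel K] (π : Measure S) : Prop :=
  ∃ C r : ℝ, 0 ≤ r ∧ r < 1 ∧ ∀ (n : ℕ) (x : S),
    tvDist ((chainLaw K x).map (fun w => w n)) π ≤ ENNReal.ofReal (C * r ^ n)

end MarkovChains

/-! ### The direction chain of a random coefficient autoregressive model -/

section Model

/-- The companion matrix with first row `α₁, …, α_q` and the identity matrix of order `q - 1`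
below it (followed by a zero column). -/
def companion {q : ℕ} (α : Fin q → ℝ) : Matrix (Fin q) (Fin q) ℝ :=
  Matrix.of fun i j => if (i : ℕ) = 0 then α j else if (j : ℕ) + 1 = i then 1 else 0

/-- The Frobenius norm, `|A|² = tr (A A')`. -/
noncomputable def frobNorm {q : ℕ} (A : Matrix (Fin q) (Fin q) ℝ) : ℝ :=
  Real.sqrt (A * A.transpose).trace

/-- The unit sphere of `ℝ^q` for the Euclidean norm. -/
abbrev USphere (q : ℕ) : Type := Metric.sphere (0 : EuclideanSpace ℝ (Fin q)) 1

/-- The row vector `x' A`, as an element of Euclidean space. -/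
noncomputable def rowMul {q : ℕ} (x : EuclideanSpace ℝ (Fin q)) (A : Matrix (Fin q) (Fin q) ℝ) :
    EuclideanSpace ℝ (Fin q) :=
  WithLp.toLp 2 (Matrix.vecMul x.ofLp A)

open Classical in
/-- One step of the direction chain, `x' A / |x' A|`. In the exceptional case `x' A = 0`, which has
probability zero for the models considered, the point does not move. -/
noncomputable def dirStep {q : ℕ} (x : USphere q) (A : Matrix (Fin q) (Fin q) ℝ) : USphere q :=
  if h : rowMul (x : EuclideanSpace ℝ (Fin q)) A = 0 then x
  else ⟨‖rowMul (x : EuclideanSpace ℝ (Fin q)) A‖⁻¹ • rowMul (x : EuclideanSpace ℝ (Fin q)) A, by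
    rw [mem_sphere_zero_iff_norm, norm_smul, norm_inv, norm_norm]
    exact inv_mul_cancel₀ (norm_ne_zero_iff.2 h)⟩

theorem measurable_rowMul_companion {q : ℕ} :
    Measurable fun p : USphere q × (Fin q → ℝ) =>
      rowMul (p.1 : EuclideanSpace ℝ (Fin q)) (companion p.2) := by
  refine (PiLp.continuous_toLp 2 _).measurable.comp ?_
  refine measurable_pi_lambda _ fun j => ?_
  simp only [Matrix.vecMul, dotProduct, companion, Matrix.of_apply]
  refine Finset.measurable_sum _ fun i _ => ?_
  refine Measurable.mul ?_ ?_
  · have h : Continuous fun p : USphere q × (Fin q → ℝ) =>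
        ((p.1 : EuclideanSpace ℝ (Fin q))).ofLp i := by fun_prop
    exact h.measurable
  · split_ifs
    · exact (measurable_pi_apply j).comp measurable_snd
    · exact measurable_const
    · exact measurable_const

theorem measurable_dirStep_companion {q : ℕ} :
    Measurable fun p : USphere q × (Fin q → ℝ) => dirStep p.1 (companion p.2) := by
  classical
  have hm := measurable_rowMul_companion (q := q)
  refine Measurable.subtype_mk (p := fun x => x ∈ Metric.sphere (0 : EuclideanSpace ℝ (Fin q)) 1)
    (f := fun p : USphere q × (Fin q → ℝ) =>
      ((dirStep p.1 (companion p.2) : USphere q) : EuclideanSpace ℝ (Fin q)))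
    (h := fun p => (dirStep p.1 (companion p.2)).2) ?_
  have h : (fun p : USphere q × (Fin q → ℝ) =>
      ((dirStep p.1 (companion p.2) : USphere q) : EuclideanSpace ℝ (Fin q))) =
      fun p => if rowMul (p.1 : EuclideanSpace ℝ (Fin q)) (companion p.2) = 0
        then (p.1 : EuclideanSpace ℝ (Fin q))
        else ‖rowMul (p.1 : EuclideanSpace ℝ (Fin q)) (companion p.2)‖⁻¹ •
          rowMul (p.1 : EuclideanSpace ℝ (Fin q)) (companion p.2) := by
    funext p
    by_cases h0 : rowMul (p.1 : EuclideanSpace ℝ (Fin q)) (companion p.2) = 0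
    · simp [dirStep, h0]
    · simp [dirStep, h0]
  rw [h]
  exact Measurable.ite (hm (measurableSet_singleton 0)) (measurable_subtype_coe.comp measurable_fst)
    (hm.norm.inv.smul hm)

/-- The transition kernel of the direction chain when the first row of the companion matrix has law
`ρ`: the kernel sends `x` to the law of `x' A / |x' A|`. -/
noncomputable def directionKernel {q : ℕ} (ρ : Measure (Fin q → ℝ)) [SFinite ρ] :
    Kernel (USphere q) (USphere q) where
  toFun x := ρ.map (fun α => dirStep x (companion α))
  measurable' := by
    refine Measure.measurable_of_measurable_coe _ fun B hB => ?_
    have h : ∀ x : USphere q, (ρ.map (fun α => dirStep x (companion α))) B =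
        ρ (Prod.mk x ⁻¹' ((fun p : USphere q × (Fin q → ℝ) =>
          dirStep p.1 (companion p.2)) ⁻¹' B)) := fun x =>
      Measure.map_apply (measurable_dirStep_companion.comp measurable_prodMk_left) hB
    simp only [h]
    exact measurable_measure_prodMk_left (measurable_dirStep_companion hB)

/-- The weight `|x' A|^l h(x' A / |x' A|) / h(x)` of the exponential change of measure. -/
noncomputable def tiltWeight {q : ℕ} (l : ℝ) (h : C(USphere q, ℝ)) (x : USphere q)
    (α : Fin q → ℝ) : ℝ :=
  ‖rowMul (x : EuclideanSpace ℝ (Fin q)) (companion α)‖ ^ l * h (dirStep x (companion α)) / h x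

theorem measurable_tiltWeight {q : ℕ} (l : ℝ) (h : C(USphere q, ℝ)) :
    Measurable fun p : USphere q × (Fin q → ℝ) => tiltWeight l h p.1 p.2 :=
  ((measurable_rowMul_companion.norm.pow_const l).mul
    (h.continuous.measurable.comp measurable_dirStep_companion)).div
      (h.continuous.measurable.comp measurable_fst)

/-- The transition kernel of the exponentially tilted direction chain: the kernel sends `x` to the
measure `B ↦ h(x)⁻¹ E[|x' A|^l h(x' A / |x' A|); x' A / |x' A| ∈ B]`. -/
noncomputable def tiltedKernel {q : ℕ} (ρ : Measure (Fin q → ℝ)) [SFinite ρ] (l : ℝ)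
    (h : C(USphere q, ℝ)) : Kernel (USphere q) (USphere q) where
  toFun x := (ρ.withDensity fun α => ENNReal.ofReal (tiltWeight l h x α)).map
    (fun α => dirStep x (companion α))
  measurable' := by
    refine Measure.measurable_of_measurable_coe _ fun B hB => ?_
    have hs : ∀ x : USphere q, Measurable fun α : Fin q → ℝ => dirStep x (companion α) :=
      fun x => measurable_dirStep_companion.comp measurable_prodMk_left
    have key : ∀ x : USphere q,
        ((ρ.withDensity fun α => ENNReal.ofReal (tiltWeight l h x α)).map
          (fun α => dirStep x (companion α))) B =
        ∫⁻ α, ((fun p : USphere q × (Fin q → ℝ) => dirStep p.1 (companion p.2)) ⁻¹' B).indicator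
          (fun p => ENNReal.ofReal (tiltWeight l h p.1 p.2)) (x, α) ∂ρ := by
      intro x
      rw [Measure.map_apply (hs x) hB, withDensity_apply _ (hs x hB),
        ← lintegral_indicator (hs x hB)]
      rfl
    simp only [key]
    exact Measurable.lintegral_prod_right'
      (((measurable_tiltWeight l h).ennreal_ofReal).indicator (measurable_dirStep_companion hB))

variable {Ω : Type*} [MeasurableSpace Ω]

/-- The random coefficients `α_{in} = a_i + σ_i η_{in}`; time `n = 1, 2, …` and the coordinate
`i = 1, …, q` are both numbered from `0`. -/
def coeff {q : ℕ} (a σ : Fin q → ℝ) (η : ℕ → Fin q → Ω → ℝ) (n : ℕ) (ω : Ω) : Fin q → ℝ :=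
  fun i => a i + σ i * η n i ω

/-- The random companion matrices; `randMat a σ η n` is the matrix usually written `A_{n+1}`. -/
def randMat {q : ℕ} (a σ : Fin q → ℝ) (η : ℕ → Fin q → Ω → ℝ) (n : ℕ) (ω : Ω) :
    Matrix (Fin q) (Fin q) ℝ :=
  companion (coeff a σ η n ω)

/-- The product `A_1 ⋯ A_n` of the first `n` matrices. -/
def matProd {q : ℕ} (a σ : Fin q → ℝ) (η : ℕ → Fin q → Ω → ℝ) : ℕ → Ω → Matrix (Fin q) (Fin q) ℝ
  | 0, _ => 1
  | n + 1, ω => matProd a σ η n ω * randMat a σ η n ω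

/-- The direction process `x_0 = x`, `x_n' = x_{n-1}' A_n / |x_{n-1}' A_n|`. -/
noncomputable def dirProcess {q : ℕ} (a σ : Fin q → ℝ) (η : ℕ → Fin q → Ω → ℝ) (x : USphere q) :
    ℕ → Ω → USphere q
  | 0, _ => x
  | n + 1, ω => dirStep (dirProcess a σ η x n ω) (randMat a σ η n ω)

/-- The law of the coefficient vector `(α_{11}, …, α_{q1})`. -/
noncomputable def coeffLaw {q : ℕ} (P : Measure Ω) (a σ : Fin q → ℝ) (η : ℕ → Fin q → Ω → ℝ) :
    Measure (Fin q → ℝ) :=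
  P.map (coeff a σ η 0)

instance instIsFiniteMeasureCoeffLaw {q : ℕ} (P : Measure Ω) [IsFiniteMeasure P] (a σ : Fin q → ℝ)
    (η : ℕ → Fin q → Ω → ℝ) : IsFiniteMeasure (coeffLaw P a σ η) := by
  unfold coeffLaw
  infer_instance

/-- The variables `η_{in}` are i.i.d. (in `i` and `n`) with a symmetric, continuous, positive
density `φ` which is nonincreasing on `[0, ∞)`, and they have moments of all orders. -/
structure CondD1 {q : ℕ} (P : Measure Ω) (η : ℕ → Fin q → Ω → ℝ) (φ : ℝ → ℝ) : Prop where
  measurable : ∀ n i, Measurable (η n i)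
  indep : iIndepFun (fun p : ℕ × Fin q => η p.1 p.2) P
  law : ∀ n i, P.map (η n i) = volume.withDensity fun t => ENNReal.ofReal (φ t)
  continuous : Continuous φ
  pos : ∀ t, 0 < φ t
  symm : ∀ t, φ (-t) = φ t
  antitone : AntitoneOn φ (Set.Ici 0)
  moments : ∀ (n : ℕ) (i : Fin q) (k : ℕ), Integrable (fun ω => |η n i ω| ^ k) P

/-- Normalisation of the model: nonnegative `σ_i`, and `η_{i1}` has mean `0` and second
moment `1`. -/
structure ModelNormalised {q : ℕ} (P : Measure Ω) (σ : Fin q → ℝ) (η : ℕ → Fin q → Ω → ℝ) :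
    Prop where
  sigma_nonneg : ∀ i, 0 ≤ σ i
  mean : ∀ i, ∫ ω, η 0 i ω ∂P = 0
  second_moment : ∀ i, ∫ ω, η 0 i ω ^ 2 ∂P = 1

/-- For some `m`, `E (α_{11} - a_1)^{2m}` is finite and larger than `1`; the index `i₁` stands for
the first coordinate. -/
def CondD2 {q : ℕ} (P : Measure Ω) (a σ : Fin q → ℝ) (η : ℕ → Fin q → Ω → ℝ) (i₁ : Fin q) : Prop :=
  ∃ m : ℕ, Integrable (fun ω => (coeff a σ η 0 ω i₁ - a i₁) ^ (2 * m)) P ∧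
    1 < ∫ ω, (coeff a σ η 0 ω i₁ - a i₁) ^ (2 * m) ∂P

/-- `k` is the limit of `(E |A_1 ⋯ A_n|^l)^{1/n}` as `n → ∞`. -/
def IsKappa {q : ℕ} (P : Measure Ω) (a σ : Fin q → ℝ) (η : ℕ → Fin q → Ω → ℝ) (l k : ℝ) : Prop :=
  Tendsto (fun n : ℕ => (∫ ω, frobNorm (matProd a σ η n ω) ^ l ∂P) ^ ((1 : ℝ) / n)) atTop (𝓝 k)

/-- The operator `Q_l f (x) = E |x' A_1|^l f(x' A_1 / |x' A_1|)`. -/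
noncomputable def transferOp {q : ℕ} (P : Measure Ω) (a σ : Fin q → ℝ) (η : ℕ → Fin q → Ω → ℝ)
    (l : ℝ) (f : USphere q → ℝ) (x : USphere q) : ℝ :=
  ∫ ω, ‖rowMul (x : EuclideanSpace ℝ (Fin q)) (randMat a σ η 0 ω)‖ ^ l *
    f (dirStep x (randMat a σ η 0 ω)) ∂P

/-- Lebesgue (surface) measure on the unit sphere. -/
noncomputable def sphereLebesgue (q : ℕ) : Measure (USphere q) :=
  (volume : Measure (EuclideanSpace ℝ (Fin q))).toSphere

end Model

/-!
Both assertions are instances of one statement about the tilted kernel with an exponent `l ≥ 0` and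
a positive continuous `h`: for `l = 0` and `h = 1` the weight is `1`, and the tilted kernel is the
kernel of the direction chain itself (`directionKernel_eq_tiltedKernel`).

**The transition probabilities after finitely many steps are equivalent to surface measure.**
Write `α` for the random first row of a companion matrix, and let `reach ρ D` be the set of row
vectors `y` with `P (y' A ∈ D) > 0`. Only three properties of the law `ρ` of `α` matter
(`IsSpreadRow`): the law of `α_1` is equivalent to Lebesgue measure, translations in the direction of
the first coordinate preserve `ρ`-null sets, and `α_q ≠ 0` almost surely. As `A` is almost surely
invertible, `D` is null if and only if `reach ρ D` is. Since `(y' A)_1 = y_1 α_1 + y_2`, a change of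
`y_2` can be undone by a translation of `α_1`; hence, as long as `y_1 ≠ 0`, every application of
`reach` removes the dependence on one more coordinate (`mem_iterate_reach_of_eq`). After `q` steps
nothing is left, so `y` belongs to the `q`-th iterate exactly when `D` has positive measure. A vector
with `y_1 = 0` is shifted to the left until its first coordinate is nonzero, so `2 q - 1` steps
suffice for all `y ≠ 0` (`mem_iterate_reach_iff`). Applied to cones this concerns the directions, and
the almost surely positive weights do not matter
(`tiltedKernel_pow_apply_eq_zero_iff_sphereLebesgue`).

**Equivalence and the Feller property imply a Doeblin minorization.** Let `L` be a power of the
kernel whose transition probabilities are all equivalent to a measure `Λ` charging the open sets. The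
density of `L` relative to `Λ` is positive, so it exceeds some constant outside a set of small measure, and the two-step
density is bounded below on a product `C × D` (`exists_small_set`). Here `C` may be taken closed; then
the sets `{x | 1 / n ≤ L x C}` are closed and cover the sphere, and Baire's theorem gives an open set
`O` on which `L x C` is bounded below. Finally `L x O` is lower semicontinuous and positive on a
compact space, hence bounded below. Together these bounds give
`L ^ 4 ≥ ε ν` (`IsFeller.exists_minorization`). The Feller property of the tilted kernel follows from
dominated convergence and the moment condition (`isFeller_tiltedKernel`).

**Consequences of the minorization** (`IsFeller.ergodic`). The minorization contracts the oscillation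
of bounded functions, so all `n`-step probabilities merge geometrically; a weak limit point is then an
invariant probability measure. It is equivalent to surface measure because the transition
probabilities are, and sets of positive measure are hit with a probability bounded below after a fixed
number of steps, which gives Harris recurrence.

The formula for the law of the tilted path (`lintegral_chainLaw_tiltedKernel`) is proved by induction
on the number of steps, from the independence of the matrices and the multiplicativity of
`|x' A_1 ⋯ A_n|` along the direction process.
-/

/-! ### The path law of a Markov chain -/

section PathLaw

variable {S : Type*} [MeasurableSpace S]

instance chainLaw.instIsProbabilityMeasure (K : Kernel S S) [IsMarkovKernel K] (x : S) :
    IsProbabilityMeasure (chainLaw K x) := by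
  unfold chainLaw
  infer_instance

instance kernelPow.instIsMarkovKernel (K : Kernel S S) [IsMarkovKernel K] (n : ℕ) :
    IsMarkovKernel (K ^ n) := by
  induction n with
  | zero => rw [pow_zero]; exact inferInstanceAs (IsMarkovKernel Kernel.id)
  | succ n ih => rw [pow_succ]; exact inferInstanceAs (IsMarkovKernel ((K ^ n) ∘ₖ K))

/-- The Markov property in integrated form: given the path up to time `n`, the state at time
`n + 1` has law `K (w n)`. -/
theorem lintegral_chainLaw_succ (K : Kernel S S) [IsMarkovKernel K] (x : S) (n : ℕ)
    {G : ((_ : Finset.Iic n) → S) × S → ℝ≥0∞} (hG : Measurable G) :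
    ∫⁻ w, G (Preorder.frestrictLe (π := fun _ => S) n w, w (n + 1)) ∂(chainLaw K x) =
      ∫⁻ w, ∫⁻ y, G (Preorder.frestrictLe (π := fun _ => S) n w, y) ∂(K (w n))
        ∂(chainLaw K x) := by
  set κ : (n : ℕ) → Kernel ((i : Finset.Iic n) → S) S := fun n =>
    K.comap (fun w : (i : Finset.Iic n) → S => w ⟨n, Finset.mem_Iic.2 le_rfl⟩)
      (measurable_pi_apply _) with hκ
  have h1 := Kernel.partialTraj_compProd_eq_map_traj (X := fun _ => S) (κ := κ) (Nat.zero_le n)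
    (x₀ := fun _ => x)
  have hL : chainLaw K x = Kernel.traj (X := fun _ => S) κ 0 (fun _ => x) := rfl
  have hm : Measurable (fun w : ℕ → S =>
      (Preorder.frestrictLe (π := fun _ => S) n w, w (n + 1))) := by fun_prop
  have h2 : ∫⁻ w, G (Preorder.frestrictLe (π := fun _ => S) n w, w (n + 1)) ∂(chainLaw K x) =
      ∫⁻ p, G p ∂((chainLaw K x).map fun w : ℕ → S =>
        (Preorder.frestrictLe (π := fun _ => S) n w, w (n + 1))) :=
    (lintegral_map hG hm).symm
  rw [h2, hL, ← h1, Measure.lintegral_compProd hG, ← Kernel.traj_map_frestrictLe_apply,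
    lintegral_map _ (by fun_prop)]
  · rfl
  · exact Measurable.lintegral_kernel_prod_right' hG

theorem lintegral_chainLaw_zero (K : Kernel S S) [IsMarkovKernel K] (x : S)
    {G : ((_ : Finset.Iic 0) → S) → ℝ≥0∞} (hG : Measurable G) :
    ∫⁻ w, G (Preorder.frestrictLe (π := fun _ => S) 0 w) ∂(chainLaw K x) = G fun _ => x := by
  set κ : (n : ℕ) → Kernel ((i : Finset.Iic n) → S) S := fun n =>
    K.comap (fun w : (i : Finset.Iic n) → S => w ⟨n, Finset.mem_Iic.2 le_rfl⟩)
      (measurable_pi_apply _) with hκ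
  have hL : chainLaw K x = Kernel.traj (X := fun _ => S) κ 0 (fun _ => x) := rfl
  have h := Kernel.traj_map_frestrictLe_apply (X := fun _ => S) (κ := κ) 0 0 (fun _ => x)
  rw [Kernel.partialTraj_self, Kernel.id_apply, ← hL] at h
  rw [← lintegral_map hG (by fun_prop), h, lintegral_dirac' _ hG]

/-- The Markov property over `m` steps. -/
theorem lintegral_chainLaw_add (K : Kernel S S) [IsMarkovKernel K] (x : S) (n m : ℕ)
    {G : ((_ : Finset.Iic n) → S) → ℝ≥0∞} (hG : Measurable G) {g : S → ℝ≥0∞}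
    (hg : Measurable g) :
    ∫⁻ w, G (Preorder.frestrictLe (π := fun _ => S) n w) * g (w (n + m)) ∂(chainLaw K x) =
      ∫⁻ w, G (Preorder.frestrictLe (π := fun _ => S) n w) * ∫⁻ y, g y ∂((K ^ m) (w n))
        ∂(chainLaw K x) := by
  induction m generalizing g with
  | zero =>
    refine lintegral_congr fun w => ?_
    have : K ^ 0 = Kernel.id := pow_zero K
    rw [this, Kernel.id_apply, lintegral_dirac' _ hg, add_zero]
  | succ m ih =>
    have hle : n ≤ n + m := Nat.le_add_right n m
    have hG' : Measurable fun p : ((_ : Finset.Iic (n + m)) → S) × S =>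
        G (Preorder.frestrictLe₂ (π := fun _ => S) hle p.1) * g p.2 :=
      (hG.comp ((Preorder.measurable_frestrictLe₂ (X := fun _ => S) hle).comp measurable_fst)).mul
        (hg.comp measurable_snd)
    have h1 := lintegral_chainLaw_succ K x (n + m) hG'
    have h2 : ∀ w : ℕ → S, ∫⁻ y, G (Preorder.frestrictLe (π := fun _ => S) n w) * g y
        ∂(K (w (n + m))) = G (Preorder.frestrictLe (π := fun _ => S) n w) *
          ∫⁻ y, g y ∂(K (w (n + m))) := fun w => lintegral_const_mul _ hg
    refine h1.trans ?_
    refine (lintegral_congr h2).trans ?_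
    rw [ih (g := fun z => ∫⁻ y, g y ∂(K z)) (hg.lintegral_kernel)]
    refine lintegral_congr fun w => ?_
    have h3 : K ^ (m + 1) = K ∘ₖ (K ^ m) := pow_succ' K m
    rw [h3, Kernel.lintegral_comp _ _ _ hg]

theorem chainLaw_map_eval (K : Kernel S S) [IsMarkovKernel K] (x : S) (n : ℕ) :
    (chainLaw K x).map (fun w => w n) = (K ^ n) x := by
  refine Measure.ext_of_lintegral _ fun g hg => ?_
  have h1 := lintegral_chainLaw_add K x 0 n (G := fun _ => 1) measurable_const hg
  have h2 := lintegral_chainLaw_zero K x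
    (G := fun v => ∫⁻ y, g y ∂((K ^ n) (v ⟨0, Finset.mem_Iic.2 le_rfl⟩)))
    ((hg.lintegral_kernel (κ := K ^ n)).comp (measurable_pi_apply _))
  rw [lintegral_map hg (measurable_pi_apply n)]
  simp only [one_mul, zero_add] at h1
  exact h1.trans h2

/-- If every `ψ`-positive set is reached in some fixed number of steps with a probability that is
bounded away from zero uniformly in the starting point, then the chain is Harris recurrent: along
the multiples of that number of steps, the probability of avoiding the set decays geometrically. -/
theorem isHarrisRecurrent_of_uniform_lower_bound (K : Kernel S S) [IsMarkovKernel K]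
    (ψ : Measure S) [SigmaFinite ψ] (hψ : ψ ≠ 0)
    (h : ∀ A, MeasurableSet A → 0 < ψ A → ∃ m : ℕ, ∃ δ : ℝ≥0∞, 0 < δ ∧ ∀ x, δ ≤ (K ^ m) x A) :
    IsHarrisRecurrent K := by
  refine ⟨ψ, inferInstance, hψ, fun A hA hψA x => ?_⟩
  obtain ⟨m, δ, hδ, hK⟩ := h A hA hψA
  simp only [frequently_atTop]
  rw [ae_all_iff]
  intro k
  set E : ℕ → Set (ℕ → S) := fun j => {w | ∀ i < j, w (k + (i + 1) * m) ∉ A} with hE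
  have hEm : ∀ j, MeasurableSet (E j) := fun j => by
    have : E j = ⋂ i, ⋂ (_ : i < j), (fun w : ℕ → S => w (k + (i + 1) * m)) ⁻¹' Aᶜ := by
      ext w; simp [hE]
    rw [this]
    exact MeasurableSet.iInter fun i => MeasurableSet.iInter fun _ =>
      (measurable_pi_apply _) hA.compl
  have hstep : ∀ j, chainLaw K x (E j) ≤ (1 - δ) ^ j := by
    intro j
    induction j with
    | zero => simpa using prob_le_one
    | succ j ih =>
      set V : Set ((_ : Finset.Iic (k + j * m)) → S) :=
        {v | ∀ i, ∀ hi : i < j, v ⟨k + (i + 1) * m, Finset.mem_Iic.2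
          (Nat.add_le_add_left (Nat.mul_le_mul_right m hi) k)⟩ ∉ A} with hV
      have hVm : MeasurableSet V := by
        have : V = ⋂ i, ⋂ (hi : i < j), (fun v : (_ : Finset.Iic (k + j * m)) → S =>
            v ⟨k + (i + 1) * m, Finset.mem_Iic.2
              (Nat.add_le_add_left (Nat.mul_le_mul_right m hi) k)⟩) ⁻¹' Aᶜ := by
          ext v; simp [hV]
        rw [this]
        exact MeasurableSet.iInter fun i => MeasurableSet.iInter fun _ =>
          (measurable_pi_apply _) hA.compl
      have h1 := lintegral_chainLaw_add K x (k + j * m) m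
        (G := V.indicator 1) (measurable_one.indicator hVm)
        (g := Aᶜ.indicator 1) (measurable_one.indicator hA.compl)
      have h2 : ∀ w : ℕ → S, (E (j + 1)).indicator (1 : (ℕ → S) → ℝ≥0∞) w =
          V.indicator 1 (Preorder.frestrictLe (π := fun _ => S) (k + j * m) w) *
            Aᶜ.indicator 1 (w (k + j * m + m)) := by
        intro w
        have e1 : Preorder.frestrictLe (π := fun _ => S) (k + j * m) w ∈ V ↔ w ∈ E j := Iff.rfl
        have e2 : w ∈ E (j + 1) ↔ w ∈ E j ∧ w (k + j * m + m) ∈ Aᶜ := by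
          have : k + j * m + m = k + (j + 1) * m := by ring
          simp only [hE, Set.mem_ofPred_eq, Nat.lt_succ_iff_lt_or_eq, this, Set.mem_compl_iff]
          constructor
          · exact fun hh => ⟨fun i hi => hh i (Or.inl hi), hh j (Or.inr rfl)⟩
          · rintro ⟨hh1, hh2⟩ i (hi | rfl)
            · exact hh1 i hi
            · exact hh2
        by_cases a1 : w ∈ E j <;> by_cases a2 : w (k + j * m + m) ∈ Aᶜ <;>
          simp [Set.indicator, e1, e2, a1, a2]
      have h3 : ∀ y, ∫⁻ z, Aᶜ.indicator 1 z ∂((K ^ m) y) ≤ 1 - δ := fun y => by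
        rw [lintegral_indicator_one hA.compl, prob_compl_eq_one_sub hA]
        exact tsub_le_tsub_left (hK y) 1
      calc chainLaw K x (E (j + 1))
          = ∫⁻ w, (E (j + 1)).indicator 1 w ∂(chainLaw K x) :=
            (lintegral_indicator_one (hEm _)).symm
        _ = _ := lintegral_congr h2
        _ = _ := h1
        _ ≤ ∫⁻ w, (E j).indicator 1 w * (1 - δ) ∂(chainLaw K x) :=
            lintegral_mono fun w => mul_le_mul_right (h3 _) _
        _ = chainLaw K x (E j) * (1 - δ) := by
            rw [lintegral_mul_const _ (measurable_one.indicator (hEm j)),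
              lintegral_indicator_one (hEm j)]
        _ ≤ (1 - δ) ^ (j + 1) := by rw [pow_succ]; exact mul_le_mul_left ih _
  have hlim : Tendsto (fun j => (1 - δ) ^ j) atTop (𝓝 0) :=
    ENNReal.tendsto_pow_atTop_nhds_zero_of_lt_one
      (ENNReal.sub_lt_self ENNReal.one_ne_top one_ne_zero hδ.ne')
  have hzero : chainLaw K x {w | ¬ ∃ b ≥ k, w b ∈ A} = 0 := by
    refine le_antisymm (ge_of_tendsto' hlim fun j => (measure_mono ?_).trans (hstep j)) zero_le
    intro w hw i _ hi
    exact hw ⟨_, Nat.le_add_right _ _, hi⟩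
  exact hzero

end PathLaw

/-! ### Contraction under a Doeblin minorization -/

section Doeblin

variable {S : Type*} [MeasurableSpace S]

theorem abs_integral_sub_le {μ : Measure S} [IsProbabilityMeasure μ] {f : S → ℝ}
    (hf : Measurable f) {c d : ℝ} (h : ∀ x, |f x - c| ≤ d) : |∫ x, f x ∂μ - c| ≤ d := by
  have hi : Integrable f μ := by
    refine Integrable.of_bound hf.aestronglyMeasurable (d + |c|) (ae_of_all _ fun x => ?_)
    have h1 := h x
    have h2 := abs_sub_abs_le_abs_sub (f x) c
    rw [Real.norm_eq_abs]; linarith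
  have h1 : ∫ x, f x ∂μ - c = ∫ x, (f x - c) ∂μ := by
    rw [integral_sub hi (integrable_const c)]; simp
  rw [h1]
  have h2 := norm_integral_le_of_norm_le_const (μ := μ) (f := fun x => f x - c) (C := d)
    (ae_of_all _ h)
  simpa using h2

theorem integrable_of_abs_le {μ : Measure S} [IsFiniteMeasure μ] {f : S → ℝ}
    (hf : Measurable f) {d : ℝ} (h : ∀ x, |f x| ≤ d) : Integrable f μ :=
  Integrable.of_bound hf.aestronglyMeasurable d (ae_of_all _ h)

theorem measurable_integral_kernel {K : Kernel S S} [IsMarkovKernel K] {f : S → ℝ}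
    (hf : Measurable f) : Measurable fun x => ∫ y, f y ∂(K x) :=
  (hf.stronglyMeasurable.integral_kernel (κ := K)).measurable

theorem integral_kernelPow_add (K : Kernel S S) [IsMarkovKernel K] (m n : ℕ) (x : S) {f : S → ℝ}
    (hf : Measurable f) {d : ℝ} (h : ∀ x, |f x| ≤ d) :
    ∫ y, f y ∂((K ^ (m + n)) x) = ∫ z, ∫ y, f y ∂((K ^ m) z) ∂((K ^ n) x) := by
  have h1 : K ^ (m + n) = (K ^ m) ∘ₖ (K ^ n) := Kernel.pow_add K m n
  rw [h1]
  have : IsFiniteMeasure (((K ^ m) ∘ₖ (K ^ n)) x) := inferInstance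
  exact Kernel.integral_comp (integrable_of_abs_le hf h)

/-- A Doeblin minorization shrinks the range of a bounded function by the factor `1 - ε`. -/
theorem exists_abs_integral_sub_le_of_minorization {K : Kernel S S} [IsMarkovKernel K]
    {ν : Measure S} [IsProbabilityMeasure ν] {ε : ℝ} (hε : 0 ≤ ε)
    (hK : ∀ x, ENNReal.ofReal ε • ν ≤ K x) {f : S → ℝ} (hf : Measurable f) {c d : ℝ}
    (h : ∀ x, |f x - c| ≤ d) : ∃ c', ∀ x, |∫ y, f y ∂(K x) - c'| ≤ (1 - ε) * d := by
  have hb : ∀ x, |f x| ≤ d + |c| := fun x => by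
    have h2 := abs_sub_abs_le_abs_sub (f x) c
    linarith [h x]
  refine ⟨ε * ∫ y, f y ∂ν + (1 - ε) * c, fun x => ?_⟩
  have hfK : Integrable f (K x) := integrable_of_abs_le hf hb
  have hfν : Integrable f ν := integrable_of_abs_le hf hb
  have key : ∀ g : S → ℝ, Measurable g → Integrable g (K x) → (∀ y, 0 ≤ g y) →
      ε * ∫ y, g y ∂ν ≤ ∫ y, g y ∂(K x) := by
    intro g hg hgK hg0
    have h1 := integral_mono_measure (hK x) (ae_of_all _ hg0) hgK
    rwa [integral_smul_measure, ENNReal.toReal_ofReal hε, smul_eq_mul] at h1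
  have k1 := key (fun y => f y - (c - d)) (hf.sub_const _) (hfK.sub (integrable_const _))
    (fun y => by linarith [(abs_le.1 (h y)).1])
  have k2 := key (fun y => (c + d) - f y) (hf.const_sub _) ((integrable_const _).sub hfK)
    (fun y => by linarith [(abs_le.1 (h y)).2])
  rw [integral_sub hfν (integrable_const _), integral_sub hfK (integrable_const _)] at k1
  rw [integral_sub (integrable_const _) hfν, integral_sub (integrable_const _) hfK] at k2
  simp only [integral_const, probReal_univ, one_smul] at k1 k2
  rw [abs_le]
  constructor <;> nlinarith

theorem exists_abs_integral_kernelPow_sub_le {K : Kernel S S} [IsMarkovKernel K]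
    {ν : Measure S} [IsProbabilityMeasure ν] {ε : ℝ} (hε : 0 ≤ ε) {m : ℕ}
    (hK : ∀ x, ENNReal.ofReal ε • ν ≤ (K ^ m) x) (n : ℕ) {f : S → ℝ} (hf : Measurable f)
    (h : ∀ x, |f x| ≤ 1) : ∃ c, ∀ x, |∫ y, f y ∂((K ^ n) x) - c| ≤ (1 - ε) ^ (n / m) := by
  have main : ∀ k : ℕ, ∃ c, ∀ x, |∫ y, f y ∂((K ^ (m * k)) x) - c| ≤ (1 - ε) ^ k := by
    intro k
    induction k with
    | zero =>
      refine ⟨0, fun x => ?_⟩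
      rw [pow_zero]
      exact abs_integral_sub_le hf (fun x => by simpa using h x)
    | succ k ih =>
      obtain ⟨c, hc⟩ := ih
      obtain ⟨c', hc'⟩ := exists_abs_integral_sub_le_of_minorization hε hK
        (measurable_integral_kernel (K := K ^ (m * k)) hf) hc
      refine ⟨c', fun x => ?_⟩
      rw [mul_add, mul_one, integral_kernelPow_add K _ _ x hf h, pow_succ, mul_comm _ (1 - ε)]
      exact hc' x
  obtain ⟨c, hc⟩ := main (n / m)
  refine ⟨c, fun x => ?_⟩
  rw [← Nat.div_add_mod n m, integral_kernelPow_add K _ _ x hf h]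
  have := abs_integral_sub_le (μ := (K ^ (n % m)) x)
    (measurable_integral_kernel (K := K ^ (m * (n / m))) hf) hc
  rwa [Nat.div_add_mod n m]

theorem abs_integral_kernelPow_sub_le_of_invariant {K : Kernel S S} [IsMarkovKernel K]
    {ν : Measure S} [IsProbabilityMeasure ν] {ε : ℝ} (hε : 0 ≤ ε) {m : ℕ}
    (hK : ∀ x, ENNReal.ofReal ε • ν ≤ (K ^ m) x) (n : ℕ) {f : S → ℝ} (hf : Measurable f)
    (h : ∀ x, |f x| ≤ 1) (μ : Measure S) [IsProbabilityMeasure μ] (x : S) :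
    |∫ y, f y ∂((K ^ n) x) - ∫ z, ∫ y, f y ∂((K ^ n) z) ∂μ| ≤ 2 * (1 - ε) ^ (n / m) := by
  obtain ⟨c, hc⟩ := exists_abs_integral_kernelPow_sub_le hε hK n hf h
  have h1 := abs_integral_sub_le (μ := μ) (measurable_integral_kernel (K := K ^ n) hf) hc
  have h2 := hc x
  rw [abs_le] at *
  constructor <;> linarith

theorem mul_le_kernel_comp_apply {L M : Kernel S S} {A B : Set S} (hA : MeasurableSet A)
    (hB : MeasurableSet B) {c d : ℝ≥0∞} {x : S} (hL : c ≤ L x A) (hM : ∀ y ∈ A, d ≤ M y B) :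
    c * d ≤ (M ∘ₖ L) x B := by
  rw [Kernel.comp_apply' _ _ _ hB]
  calc c * d ≤ ∫⁻ _ in A, d ∂(L x) := by
        rw [setLIntegral_const, mul_comm]; gcongr
    _ ≤ ∫⁻ y in A, M y B ∂(L x) := setLIntegral_mono' hA hM
    _ ≤ _ := setLIntegral_le_lintegral _ _

theorem invariant_kernelPow {K : Kernel S S} {π : Measure S} (hπ : Kernel.Invariant K π) (n : ℕ) :
    Kernel.Invariant (K ^ n) π := by
  induction n with
  | zero =>
    rw [pow_zero]
    exact Measure.id_comp
  | succ n ih => rw [pow_succ]; exact ih.comp hπ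

theorem integral_bind_kernel {K : Kernel S S} [IsMarkovKernel K] {μ : Measure S}
    [IsProbabilityMeasure μ] {f : S → ℝ} (hf : Measurable f) {d : ℝ} (h : ∀ x, |f x| ≤ d) :
    ∫ y, f y ∂(μ.bind K) = ∫ z, ∫ y, f y ∂(K z) ∂μ := by
  have h1 := Kernel.integral_comp (η := K) (κ := Kernel.const Unit μ) (a := ())
    (integrable_of_abs_le hf h)
  rwa [Kernel.comp_apply, Kernel.const_apply] at h1

theorem integral_kernel_of_invariant {K : Kernel S S} [IsMarkovKernel K] {π : Measure S}
    [IsProbabilityMeasure π] (hπ : Kernel.Invariant K π) {f : S → ℝ} (hf : Measurable f) {d : ℝ}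
    (h : ∀ x, |f x| ≤ d) : ∫ z, ∫ y, f y ∂(K z) ∂π = ∫ y, f y ∂π := by
  rw [← integral_bind_kernel hf h, hπ.def]

/-- A Doeblin minorization of some power of the kernel yields uniform geometric ergodicity, with
any invariant probability measure as limit. -/
theorem isUniformlyGeometricallyErgodic_of_minorization {K : Kernel S S} [IsMarkovKernel K]
    {ν : Measure S} [IsProbabilityMeasure ν] {ε : ℝ} (hε : 0 < ε) (hε1 : ε < 1) {m : ℕ}
    (hm : 0 < m) (hK : ∀ x, ENNReal.ofReal ε • ν ≤ (K ^ m) x) {π : Measure S}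
    [IsProbabilityMeasure π] (hπ : Kernel.Invariant K π) :
    IsUniformlyGeometricallyErgodic K π := by
  set s : ℝ := 1 - ε with hs
  have hs0 : 0 < s := by linarith
  have hs1 : s < 1 := by linarith
  set r : ℝ := s ^ ((m : ℝ)⁻¹) with hr
  have hr0 : 0 < r := Real.rpow_pos_of_pos hs0 _
  have hr1 : r < 1 := Real.rpow_lt_one hs0.le hs1 (by positivity)
  have hrm : r ^ m = s := Real.rpow_inv_natCast_pow hs0.le hm.ne'
  refine ⟨2 / s, r, hr0.le, hr1, fun n x => ?_⟩
  rw [chainLaw_map_eval]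
  refine iSup_le fun f => iSup_le fun hf => iSup_le fun hb => ENNReal.ofReal_le_ofReal ?_
  have h1 := abs_integral_kernelPow_sub_le_of_invariant hε.le hK n hf hb π x
  rw [integral_kernel_of_invariant (invariant_kernelPow hπ n) hf hb] at h1
  refine h1.trans ?_
  -- `s ^ ⌊n / m⌋ ≤ r ^ n / s`, because `n < m * (⌊n / m⌋ + 1)`
  have h2 : s ^ (n / m) * s ≤ r ^ n := by
    conv_lhs => rw [← pow_succ, ← hrm, ← pow_mul]
    exact pow_le_pow_of_le_one hr0.le hr1.le (Nat.lt_mul_div_succ n hm).le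
  rw [div_mul_eq_mul_div, le_div_iff₀ hs0]
  nlinarith

end Doeblin

/-! ### Feller chains on compact spaces with equivalent transition probabilities -/

section Feller

variable {S : Type*} [MetricSpace S] [MeasurableSpace S] [BorelSpace S]

/-- The (weak) Feller property: the kernel maps bounded continuous functions
to continuous functions. -/
def IsFeller (K : Kernel S S) : Prop :=
  ∀ f : BoundedContinuousFunction S ℝ, Continuous fun x => ∫ y, f y ∂(K x)

theorem IsFeller.pow {K : Kernel S S} [IsMarkovKernel K] (hK : IsFeller K) (n : ℕ) :
    IsFeller (K ^ n) := by
  induction n with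
  | zero =>
    intro f
    have h0 : ∀ x, ∫ y, f y ∂((K ^ 0) x) = f x := fun x => by
      have : K ^ 0 = Kernel.id := pow_zero K
      rw [this, Kernel.id_apply, integral_dirac]
    simp only [h0]
    exact f.continuous
  | succ n ih =>
    intro f
    have hb : ∀ y, |f y| ≤ ‖f‖ := fun y => f.norm_coe_le_norm y
    have hb' : ∀ x, ‖∫ y, f y ∂((K ^ n) x)‖ ≤ ‖f‖ := fun x => by
      simpa using norm_integral_le_of_norm_le_const (μ := (K ^ n) x) (f := f) (ae_of_all _ hb)
    have h := hK (BoundedContinuousFunction.ofNormedAddCommGroup _ (ih f) _ hb')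
    convert h using 2 with x
    simpa using integral_kernelPow_add K n 1 x f.continuous.measurable hb

/-- The transition probabilities of a Markov kernel as a map into the space of probability
measures. -/
noncomputable def kernelProb (K : Kernel S S) [IsMarkovKernel K] (x : S) : ProbabilityMeasure S :=
  ⟨K x, inferInstance⟩

theorem IsFeller.continuous_kernelProb {K : Kernel S S} [IsMarkovKernel K] (hK : IsFeller K) :
    Continuous (kernelProb K) := by
  rw [continuous_iff_continuousAt]
  intro x
  rw [ContinuousAt, ProbabilityMeasure.tendsto_iff_forall_integral_tendsto]
  intro f
  exact (hK f).tendsto x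

theorem IsFeller.lowerSemicontinuous {K : Kernel S S} [IsMarkovKernel K] (hK : IsFeller K)
    {G : Set S} (hG : IsOpen G) : LowerSemicontinuous fun x => K x G := by
  rw [lowerSemicontinuous_iff_le_liminf]
  intro x
  exact ProbabilityMeasure.le_liminf_measure_open_of_tendsto (hK.continuous_kernelProb.tendsto x) hG

theorem IsFeller.isClosed_le_apply {K : Kernel S S} [IsMarkovKernel K] (hK : IsFeller K)
    {C : Set S} (hC : IsClosed C) (c : ℝ≥0∞) : IsClosed {x | c ≤ K x C} := by
  have h : UpperSemicontinuous fun x => K x C := by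
    rw [upperSemicontinuous_iff_limsup_le]
    intro x
    exact ProbabilityMeasure.limsup_measure_closed_le_of_tendsto
      (hK.continuous_kernelProb.tendsto x) hC
  exact h.isClosed_preimage c

/-- Existence of an invariant probability measure: a weak limit point of `K ^ n x₀` is invariant,
because consecutive powers are asymptotically equal by the minorization. -/
theorem IsFeller.exists_invariant [CompactSpace S] {K : Kernel S S} [IsMarkovKernel K] (hK : IsFeller K)
    [Nonempty S] {ν : Measure S} [IsProbabilityMeasure ν] {ε : ℝ} (hε : 0 < ε) (hε1 : ε < 1)
    {m : ℕ} (hm : 0 < m) (hmin : ∀ x, ENNReal.ofReal ε • ν ≤ (K ^ m) x) :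
    ∃ π : Measure S, IsProbabilityMeasure π ∧ Kernel.Invariant K π := by
  obtain ⟨x₀⟩ := ‹Nonempty S›
  set u : Ultrafilter (ProbabilityMeasure S) :=
    (hyperfilter ℕ).map fun n => kernelProb (K ^ n) x₀ with hu
  obtain ⟨π, -, hπ⟩ := isCompact_univ.ultrafilter_le_nhds u (by simp)
  have hlim : Tendsto (fun n => kernelProb (K ^ n) x₀) (hyperfilter ℕ : Filter ℕ) (𝓝 π) := hπ
  rw [ProbabilityMeasure.tendsto_iff_forall_integral_tendsto] at hlim
  refine ⟨π, inferInstance, ?_⟩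
  have hat : (hyperfilter ℕ : Filter ℕ) ≤ atTop := by
    rw [← Nat.cofinite_eq_atTop]; exact hyperfilter_le_cofinite
  have hmeas : IsProbabilityMeasure ((π : Measure S).bind K) :=
    inferInstanceAs (IsProbabilityMeasure (K ∘ₘ (π : Measure S)))
  refine ext_of_forall_integral_eq_of_IsFiniteMeasure fun f => ?_
  have hfb : ∀ y, |f y| ≤ ‖f‖ := fun y => f.norm_coe_le_norm y
  have e1 : ∫ x, f x ∂((π : Measure S).bind K) = ∫ z, ∫ y, f y ∂(K z) ∂(π : Measure S) :=
    integral_bind_kernel f.continuous.measurable hfb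
  rw [e1]
  have l1 := hlim (BoundedContinuousFunction.mkOfCompact ⟨_, hK f⟩)
  have l2 := hlim f
  have l3 : Tendsto (fun n => ∫ z, ∫ y, f y ∂(K z) ∂((K ^ n) x₀) - ∫ y, f y ∂((K ^ n) x₀)) atTop
      (𝓝 0) := by
    have hb0 : 0 < ‖f‖ + 1 := by positivity
    set g : S → ℝ := fun y => f y / (‖f‖ + 1) with hg
    have hgm : Measurable g := f.continuous.measurable.div_const _
    have hgb : ∀ y, |g y| ≤ 1 := fun y => by
      rw [hg, abs_div, abs_of_pos hb0, div_le_one hb0]; linarith [hfb y]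
    have hfg : ∀ y, f y = (‖f‖ + 1) * g y := fun y => by rw [hg]; field_simp
    have bound : ∀ n, |∫ z, ∫ y, f y ∂(K z) ∂((K ^ n) x₀) - ∫ y, f y ∂((K ^ n) x₀)| ≤
        (‖f‖ + 1) * (2 * (1 - ε) ^ (n / m)) := by
      intro n
      have h1 := abs_integral_kernelPow_sub_le_of_invariant hε.le hmin n hgm hgb (K x₀) x₀
      have h2 := integral_kernelPow_add K n 1 x₀ hgm hgb
      have h3 := integral_kernelPow_add K 1 n x₀ hgm hgb
      rw [pow_one] at h2 h3
      rw [← h2, add_comm n 1, h3, abs_sub_comm] at h1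
      simp_rw [hfg, integral_const_mul]
      rw [← mul_sub, abs_mul, abs_of_pos hb0]
      exact mul_le_mul_of_nonneg_left h1 hb0.le
    have hz : Tendsto (fun n : ℕ => (‖f‖ + 1) * (2 * (1 - ε) ^ (n / m))) atTop (𝓝 0) := by
      have h4 : Tendsto (fun n : ℕ => (1 - ε) ^ (n / m)) atTop (𝓝 0) :=
        (tendsto_pow_atTop_nhds_zero_of_lt_one (by linarith) (by linarith)).comp
          (Nat.tendsto_div_const_atTop hm.ne')
      simpa using (h4.const_mul 2).const_mul (‖f‖ + 1)
    exact squeeze_zero_norm bound hz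
  have l4 := l1.sub l2
  have l5 := tendsto_nhds_unique l4 (l3.mono_left hat)
  exact sub_eq_zero.1 l5

end Feller

/-! ### A Doeblin minorization from equivalent transition probabilities -/

section Minorization

variable {S : Type*} [MetricSpace S] [MeasurableSpace S] [BorelSpace S] [CompactSpace S]

/-- If the set of pairs where the density of a kernel is small has small measure, then for most
`x` and most `z` the sections through `x` and through `z` are large, hence they overlap, and so the
two-step density is bounded below on a product set. -/
theorem exists_small_set {L : Kernel S S} [IsMarkovKernel L] {Λ : Measure S}
    [IsProbabilityMeasure Λ] (h1 : ∀ x, L x ≪ Λ) (h2 : ∀ x, Λ ≪ L x) :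
    ∃ C D : Set S, MeasurableSet C ∧ MeasurableSet D ∧ 0 < Λ C ∧ 0 < Λ D ∧
      ∃ δ : ℝ≥0∞, 0 < δ ∧ ∀ x ∈ C, δ • Λ.restrict D ≤ (L ^ 2) x := by
  set p : S → S → ℝ≥0∞ := L.rnDeriv (Kernel.const S Λ) with hp
  have hpm : Measurable fun q : S × S => p q.1 q.2 := Kernel.measurable_rnDeriv _ _
  have hpL : ∀ x {B : Set S}, MeasurableSet B → L x B = ∫⁻ y in B, p x y ∂Λ := by
    intro x B hB
    have := Kernel.setLIntegral_rnDeriv (κ := L) (η := Kernel.const S Λ) (a := x)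
      (by simpa using h1 x) hB
    simpa using this.symm
  have hp0 : ∀ x, ∀ᵐ y ∂Λ, p x y ≠ 0 := by
    intro x
    have hz : MeasurableSet {y | p x y = 0} :=
      (hpm.comp measurable_prodMk_left) (measurableSet_singleton 0)
    have : Λ {y | p x y = 0} = 0 := by
      refine h2 x ?_
      rw [hpL x hz]
      exact (setLIntegral_congr_fun hz fun y hy => hy).trans (by simp)
    rw [ae_iff]
    simpa using this
  -- the exceptional set where the density is at most `1 / (n + 1)`
  set N : ℕ → Set (S × S) := fun n => {q | p q.1 q.2 ≤ ((n : ℝ≥0∞) + 1)⁻¹} with hN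
  have hNm : ∀ n, MeasurableSet (N n) := fun n => hpm measurableSet_Iic
  have hNanti : Antitone N := by
    intro i j hij q hq
    refine le_trans (show p q.1 q.2 ≤ ((j : ℝ≥0∞) + 1)⁻¹ from hq) (ENNReal.inv_le_inv.2 ?_)
    gcongr
  have hN0 : (Λ.prod Λ) (⋂ n, N n) = 0 := by
    rw [Measure.measure_prod_null (MeasurableSet.iInter hNm)]
    refine ae_of_all _ fun x => ?_
    refine measure_mono_null ?_ (hp0 x)
    intro y hy hne
    obtain ⟨n, hn⟩ := ENNReal.exists_inv_nat_lt hne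
    have h3 : p x y ≤ ((n : ℝ≥0∞) + 1)⁻¹ := (Set.mem_iInter.1 hy n : (x, y) ∈ N n)
    refine absurd (h3.trans (ENNReal.inv_le_inv.2 le_self_add)) (not_le.2 hn)
  have hNlim : Tendsto (fun n => (Λ.prod Λ) (N n)) atTop (𝓝 0) := by
    rw [← hN0]
    exact tendsto_measure_iInter_atTop (fun n => (hNm n).nullMeasurableSet) hNanti
      ⟨0, measure_ne_top _ _⟩
  have h4 : (0 : ℝ≥0∞) < 4⁻¹ := by simp
  obtain ⟨n, hn⟩ := (hNlim.eventually_lt_const h4).exists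
  set d : ℝ≥0∞ := ((n : ℝ≥0∞) + 1)⁻¹ with hd
  have hd0 : d ≠ 0 := by rw [hd]; simp
  set s : S → Set S := fun x => {y | p x y ≤ d} with hs
  set t : S → Set S := fun z => {y | p y z ≤ d} with ht
  have hsm : ∀ x, MeasurableSet (s x) := fun x => (hpm.comp measurable_prodMk_left) measurableSet_Iic
  have htm : ∀ x, MeasurableSet (t x) := fun x =>
    (hpm.comp measurable_prodMk_right) measurableSet_Iic
  have hsf : Measurable fun x => Λ (s x) := measurable_measure_prodMk_left (hNm n)
  have htf : Measurable fun x => Λ (t x) := measurable_measure_prodMk_right (hNm n)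
  have hsi : ∫⁻ x, Λ (s x) ∂Λ < 4⁻¹ := by rwa [Measure.prod_apply (hNm n)] at hn
  have hti : ∫⁻ x, Λ (t x) ∂Λ < 4⁻¹ := by rwa [Measure.prod_apply_symm (hNm n)] at hn
  have hpos : ∀ f : S → ℝ≥0∞, ∫⁻ x, f x ∂Λ < 4⁻¹ → 0 < Λ {x | f x ≤ 4⁻¹} := by
    intro f hf
    rw [pos_iff_ne_zero]
    intro h0
    have : ∀ᵐ x ∂Λ, (4⁻¹ : ℝ≥0∞) ≤ f x := by
      filter_upwards [measure_eq_zero_iff_ae_notMem.1 h0] with x hx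
      exact (not_le.1 hx).le
    have h5 := lintegral_mono_ae this
    simp only [lintegral_const, measure_univ, mul_one] at h5
    exact absurd h5 (not_le.2 hf)
  refine ⟨{x | Λ (s x) ≤ 4⁻¹}, {x | Λ (t x) ≤ 4⁻¹}, hsf measurableSet_Iic, htf measurableSet_Iic,
    hpos _ hsi, hpos _ hti, d * d * 2⁻¹, ?_, ?_⟩
  · exact ENNReal.mul_pos (mul_ne_zero hd0 hd0) (by simp)
  intro x hx
  set D : Set S := {x | Λ (t x) ≤ 4⁻¹} with hD
  have hDm : MeasurableSet D := htf measurableSet_Iic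
  rw [Measure.le_iff]
  intro B hB
  have hL2 : (L ^ 2) x B = ∫⁻ y, p x y * ∫⁻ z in B, p y z ∂Λ ∂Λ := by
    have e1 := Kernel.pow_succ_apply_eq_lintegral L 1 x hB
    rw [pow_one] at e1
    have hpx : Measurable (p x) := hpm.comp measurable_prodMk_left
    have e2 : L x = Λ.withDensity (p x) := by
      ext A hA
      rw [hpL x hA, withDensity_apply _ hA]
    rw [e1]
    conv_lhs => rw [e2]
    rw [lintegral_withDensity_eq_lintegral_mul _ hpx
      (Kernel.measurable_coe L hB)]
    refine lintegral_congr fun y => ?_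
    simp only [Pi.mul_apply, hpL y hB]
  have hsum : ∀ z ∈ D, 2⁻¹ ≤ Λ ((s x)ᶜ ∩ (t z)ᶜ) := by
    intro z hz
    rw [← Set.compl_union, prob_compl_eq_one_sub ((hsm x).union (htm z))]
    have h6 : Λ (s x ∪ t z) ≤ 2⁻¹ := by
      refine (measure_union_le _ _).trans ((add_le_add hx hz).trans_eq ?_)
      rw [← two_mul, show (4 : ℝ≥0∞) = 2 * 2 by norm_num, ENNReal.mul_inv (by simp) (by simp),
        ← mul_assoc, ENNReal.mul_inv_cancel (by simp) (by simp), one_mul]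
    calc (2⁻¹ : ℝ≥0∞) = 1 - 2⁻¹ := ENNReal.one_sub_inv_two.symm
      _ ≤ 1 - Λ (s x ∪ t z) := tsub_le_tsub_left h6 1
  rw [hL2]
  calc (d * d * 2⁻¹) • Λ.restrict D B = ∫⁻ _ in B ∩ D, d * d * 2⁻¹ ∂Λ := by
        rw [Measure.restrict_apply hB, smul_eq_mul, setLIntegral_const]
    _ ≤ ∫⁻ z in B ∩ D, ∫⁻ y, p x y * p y z ∂Λ ∂Λ := by
        refine setLIntegral_mono' (hB.inter hDm) fun z hz => ?_
        calc d * d * 2⁻¹ ≤ d * d * Λ ((s x)ᶜ ∩ (t z)ᶜ) := by gcongr; exact hsum z hz.2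
          _ = ∫⁻ _ in (s x)ᶜ ∩ (t z)ᶜ, d * d ∂Λ := by rw [setLIntegral_const]
          _ ≤ ∫⁻ y in (s x)ᶜ ∩ (t z)ᶜ, p x y * p y z ∂Λ := by
              refine setLIntegral_mono' ((hsm x).compl.inter (htm z).compl) fun y hy => ?_
              exact mul_le_mul' (lt_of_not_ge (show ¬ p x y ≤ d from hy.1)).le
                (lt_of_not_ge (show ¬ p y z ≤ d from hy.2)).le
          _ ≤ _ := setLIntegral_le_lintegral _ _
    _ ≤ ∫⁻ z in B, ∫⁻ y, p x y * p y z ∂Λ ∂Λ := lintegral_mono_set Set.inter_subset_left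
    _ = ∫⁻ y, ∫⁻ z in B, p x y * p y z ∂Λ ∂Λ := by
        refine lintegral_lintegral_swap (Measurable.aemeasurable ?_)
        exact (hpm.comp (measurable_const.prodMk measurable_snd)).mul
          (hpm.comp (measurable_snd.prodMk measurable_fst))
    _ = _ := by
        refine lintegral_congr fun y => ?_
        have hpy : Measurable (p y) := hpm.comp measurable_prodMk_left
        rw [lintegral_const_mul _ hpy]

/-- For a closed set `C`, the sets `{x | 1 / (n + 1) ≤ L x C}` are closed by the Feller property;
they cover the space, so by Baire's theorem one of them has interior points. -/
theorem IsFeller.exists_isOpen_lower_bound [Nonempty S] {L : Kernel S S} [IsMarkovKernel L]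
    (hL : IsFeller L) {C : Set S} (hC : IsClosed C) (h : ∀ x, 0 < L x C) :
    ∃ O : Set S, IsOpen O ∧ O.Nonempty ∧ ∃ c : ℝ≥0∞, 0 < c ∧ ∀ x ∈ O, c ≤ L x C := by
  obtain ⟨n, hn⟩ := nonempty_interior_of_iUnion_of_closed
    (f := fun n : ℕ => {x | ((n : ℝ≥0∞))⁻¹ ≤ L x C}) (fun n => hL.isClosed_le_apply hC _) (by
      refine Set.eq_univ_of_forall fun x => ?_
      obtain ⟨n, hn⟩ := ENNReal.exists_inv_nat_lt (h x).ne'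
      exact Set.mem_iUnion.2 ⟨n, hn.le⟩)
  refine ⟨_, isOpen_interior, hn, (n : ℝ≥0∞)⁻¹, by simp, fun x hx => ?_⟩
  have := interior_subset hx
  exact this

theorem IsFeller.exists_uniform_lower_bound [Nonempty S] {L : Kernel S S} [IsMarkovKernel L]
    (hL : IsFeller L) {O : Set S} (hO : IsOpen O) (h : ∀ x, 0 < L x O) :
    ∃ c : ℝ≥0∞, 0 < c ∧ ∀ x, c ≤ L x O := by
  obtain ⟨x, -, hx⟩ := ((hL.lowerSemicontinuous hO).lowerSemicontinuousOn Set.univ).exists_isMinOn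
    Set.univ_nonempty isCompact_univ
  exact ⟨L x O, h x, fun y => hx (Set.mem_univ y)⟩

/-- A Feller kernel on a compact space whose transition probabilities are all equivalent to one
measure charging the open sets satisfies a Doeblin minorization after four steps: it reaches an
open set, from there a closed set, and from there two steps give the minorization. -/
theorem IsFeller.exists_minorization [Nonempty S] {L : Kernel S S} [IsMarkovKernel L]
    (hL : IsFeller L) {Λ : Measure S} [IsProbabilityMeasure Λ] [Λ.IsOpenPosMeasure]
    (h1 : ∀ x, L x ≪ Λ) (h2 : ∀ x, Λ ≪ L x) :
    ∃ (ν : Measure S) (ε : ℝ), IsProbabilityMeasure ν ∧ 0 < ε ∧ ε < 1 ∧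
      ∀ x, ENNReal.ofReal ε • ν ≤ (L ^ 4) x := by
  have hpos : ∀ {A : Set S}, 0 < Λ A → ∀ x, 0 < L x A := fun {A} hA x =>
    pos_iff_ne_zero.2 fun h0 => hA.ne' (h2 x h0)
  obtain ⟨C₀, D, hC₀, hD, hC₀pos, hDpos, δ, hδ, hsmall⟩ := exists_small_set h1 h2
  obtain ⟨C, hCC, hC, hCpos⟩ := hC₀.exists_lt_isClosed_of_ne_top (measure_ne_top Λ _) hC₀pos
  obtain ⟨O, hO, hOne, c, hc, hOC⟩ := hL.exists_isOpen_lower_bound hC (hpos hCpos)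
  obtain ⟨e, he, heO⟩ := hL.exists_uniform_lower_bound hO (hpos (hO.measure_pos Λ hOne))
  have hL2 : L ^ 2 = L ∘ₖ L := pow_two L
  have hL4 : L ^ 4 = (L ^ 2) ∘ₖ (L ^ 2) := Kernel.pow_add L 2 2
  have key : ∀ x {B : Set S}, MeasurableSet B → e * c * (δ * Λ (B ∩ D)) ≤ (L ^ 4) x B := by
    intro x B hB
    rw [hL4]
    refine mul_le_kernel_comp_apply hC.measurableSet hB ?_ fun y hy => ?_
    · rw [hL2]
      exact mul_le_kernel_comp_apply hO.measurableSet hC.measurableSet (heO x) hOC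
    · have := hsmall y (hCC hy) B
      rwa [Measure.smul_apply, Measure.restrict_apply hB, smul_eq_mul] at this
  set a : ℝ≥0∞ := min (e * c * (δ * Λ D)) 2⁻¹ with ha
  have ha0 : a ≠ 0 := by
    refine (lt_min ?_ (by simp)).ne'
    exact ENNReal.mul_pos (mul_ne_zero he.ne' hc.ne') (mul_ne_zero hδ.ne' hDpos.ne')
  have hat : a ≠ ∞ := ((min_le_right _ _).trans_lt (by simp)).ne
  refine ⟨(Λ D)⁻¹ • Λ.restrict D, a.toReal, ⟨?_⟩, ENNReal.toReal_pos ha0 hat, ?_, fun x => ?_⟩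
  · rw [Measure.smul_apply, Measure.restrict_apply_univ, smul_eq_mul,
      ENNReal.inv_mul_cancel hDpos.ne' (measure_ne_top _ _)]
  · have := ENNReal.toReal_mono (by simp) (min_le_right (e * c * (δ * Λ D)) 2⁻¹)
    refine this.trans_lt ?_
    norm_num
  · rw [ENNReal.ofReal_toReal hat, Measure.le_iff]
    intro B hB
    rw [Measure.smul_apply, Measure.smul_apply, Measure.restrict_apply hB, smul_eq_mul,
      smul_eq_mul]
    refine le_trans ?_ (key x hB)
    calc a * ((Λ D)⁻¹ * Λ (B ∩ D)) ≤ e * c * (δ * Λ D) * ((Λ D)⁻¹ * Λ (B ∩ D)) := by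
          gcongr; exact min_le_left _ _
      _ = e * c * (δ * ((Λ D * (Λ D)⁻¹) * Λ (B ∩ D))) := by ring
      _ = _ := by rw [ENNReal.mul_inv_cancel hDpos.ne' (measure_ne_top _ _), one_mul]

/-- A Feller chain on a compact space for which, for some `N ≥ 1`, all the `N`-step transition
probabilities are equivalent to the same measure charging the open sets. -/
theorem IsFeller.ergodic [Nonempty S] {K : Kernel S S} [IsMarkovKernel K] (hK : IsFeller K)
    {Λ : Measure S} [IsFiniteMeasure Λ] [Λ.IsOpenPosMeasure] {N : ℕ} (hN : 0 < N)
    (hΛ : ∀ x {B : Set S}, MeasurableSet B → ((K ^ N) x B = 0 ↔ Λ B = 0)) :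
    IsPositiveHarrisRecurrent K ∧ ∃ π : Measure S, IsProbabilityMeasure π ∧
      Kernel.Invariant K π ∧ IsUniformlyGeometricallyErgodic K π ∧ π ≪ Λ ∧ Λ ≪ π := by
  obtain ⟨x₀⟩ := ‹Nonempty S›
  have : Nonempty S := ⟨x₀⟩
  have hac1 : ∀ x, (K ^ N) x ≪ Λ := fun x =>
    Measure.AbsolutelyContinuous.mk fun B hB h => (hΛ x hB).2 h
  have hac2 : ∀ x, Λ ≪ (K ^ N) x := fun x =>
    Measure.AbsolutelyContinuous.mk fun B hB h => (hΛ x hB).1 h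
  have : ((K ^ N) x₀).IsOpenPosMeasure := (hac2 x₀).isOpenPosMeasure
  obtain ⟨ν, ε, hν, hε, hε1, hmin⟩ := (hK.pow N).exists_minorization (Λ := (K ^ N) x₀)
    (fun x => (hac1 x).trans (hac2 x₀)) (fun x => (hac1 x₀).trans (hac2 x))
  rw [← pow_mul] at hmin
  have hm : 0 < N * 4 := by positivity
  obtain ⟨π, hπ, hinv⟩ := hK.exists_invariant hε hε1 hm hmin
  have hπΛ : ∀ {B : Set S}, MeasurableSet B → (π B = 0 ↔ Λ B = 0) := by
    intro B hB
    have e1 : π B = ∫⁻ x, (K ^ N) x B ∂π := by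
      conv_lhs => rw [← (invariant_kernelPow hinv N).def]
      rw [Measure.bind_apply hB (Kernel.aemeasurable _)]
    rw [e1, lintegral_eq_zero_iff (Kernel.measurable_coe _ hB)]
    constructor
    · intro h
      obtain ⟨x, hx⟩ := h.exists
      exact (hΛ x hB).1 hx
    · exact fun h => ae_of_all _ fun x => (hΛ x hB).2 h
  have hgeo := isUniformlyGeometricallyErgodic_of_minorization hε hε1 hm hmin hinv
  have hΛ0 : Λ ≠ 0 := fun h => (isOpen_univ.measure_pos Λ ⟨x₀, trivial⟩).ne' (by simp [h])
  refine ⟨⟨?_, π, hπ, hinv⟩, π, hπ, hinv, hgeo, Measure.AbsolutelyContinuous.mk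
    fun B hB h => (hπΛ hB).2 h, Measure.AbsolutelyContinuous.mk fun B hB h => (hπΛ hB).1 h⟩
  refine isHarrisRecurrent_of_uniform_lower_bound K Λ hΛ0 fun A hA hA0 => ?_
  have hπA : 0 < π A := pos_iff_ne_zero.2 fun h => hA0.ne' ((hπΛ hA).1 h)
  obtain ⟨C, r, hr0, hr1, hCr⟩ := hgeo
  have hlim : Tendsto (fun n : ℕ => ENNReal.ofReal (C * r ^ n)) atTop (𝓝 0) := by
    have h3 := ((tendsto_pow_atTop_nhds_zero_of_lt_one hr0 hr1).const_mul C)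
    rw [mul_zero] at h3
    simpa using ENNReal.tendsto_ofReal h3
  have hhalf : π A / 2 ≠ 0 := (ENNReal.half_pos hπA.ne').ne'
  obtain ⟨n, hn⟩ := (hlim.eventually_lt_const (pos_iff_ne_zero.2 hhalf)).exists
  refine ⟨n, π A / 2, pos_iff_ne_zero.2 hhalf, fun x => ?_⟩
  -- compare the two measures on the indicator function of `A`
  have h4 := hCr n x
  rw [chainLaw_map_eval] at h4
  have h5 : ENNReal.ofReal |(∫ y, A.indicator (fun _ => (1 : ℝ)) y ∂((K ^ n) x)) -
      ∫ y, A.indicator (fun _ => (1 : ℝ)) y ∂π| ≤ tvDist ((K ^ n) x) π := by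
    refine le_iSup_of_le (A.indicator fun _ => (1 : ℝ)) (le_iSup_of_le
      (measurable_const.indicator hA) (le_iSup_of_le (fun y => ?_) le_rfl))
    by_cases hy : y ∈ A <;> simp [hy]
  rw [integral_indicator_const _ hA, integral_indicator_const _ hA] at h5
  simp only [smul_eq_mul, mul_one] at h5
  have h6 := (h5.trans h4).trans hn.le
  have h7 : π A ≤ (K ^ n) x A + π A / 2 := by
    have e1 : π A = ENNReal.ofReal (π.real A) := (ofReal_measureReal (measure_ne_top _ _)).symm
    have e2 : (K ^ n) x A = ENNReal.ofReal (((K ^ n) x).real A) :=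
      (ofReal_measureReal (measure_ne_top _ _)).symm
    calc π A = ENNReal.ofReal (π.real A) := e1
      _ ≤ ENNReal.ofReal (((K ^ n) x).real A + |((K ^ n) x).real A - π.real A|) := by
          refine ENNReal.ofReal_le_ofReal ?_
          have := neg_abs_le (((K ^ n) x).real A - π.real A)
          linarith
      _ = (K ^ n) x A + ENNReal.ofReal |((K ^ n) x).real A - π.real A| := by
          rw [ENNReal.ofReal_add measureReal_nonneg (abs_nonneg _), ← e2]
      _ ≤ _ := by gcongr
  have h8 : π A / 2 ≠ ∞ := ENNReal.div_ne_top (measure_ne_top _ _) (by simp)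
  have h9 : π A / 2 + π A / 2 ≤ (K ^ n) x A + π A / 2 := by rwa [ENNReal.add_halves]
  exact (ENNReal.add_le_add_iff_right h8).1 h9

end Minorization

/-! ### Null sets under products of random companion matrices -/

section Companion

variable {d : ℕ}

/-- The left shift of a vector, with `0` in the last place. -/
def shiftLeft (v : Fin (d + 1) → ℝ) (j : Fin (d + 1)) : ℝ :=
  if h : (j : ℕ) + 1 < d + 1 then v ⟨j + 1, h⟩ else 0

theorem vecMul_companion (v α : Fin (d + 1) → ℝ) (j : Fin (d + 1)) :
    Matrix.vecMul v (companion α) j = v 0 * α j + shiftLeft v j := by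
  rw [Matrix.vecMul, dotProduct, Fin.sum_univ_succ]
  have h0 : v 0 * companion α 0 j = v 0 * α j := rfl
  have h1 : ∑ i : Fin d, v i.succ * companion α i.succ j = shiftLeft v j := by
    simp only [companion, Matrix.of_apply, Fin.val_succ, Nat.add_eq_zero_iff, one_ne_zero, and_false,
      if_false, shiftLeft]
    split_ifs with h
    · have h' : (j : ℕ) < d := by omega
      rw [Finset.sum_eq_single ⟨j, h'⟩]
      · simp [Fin.succ]
      · intro b _ hb
        have : ¬ ((j : ℕ) + 1 = b + 1) := fun hh => hb (Fin.ext (by simp; omega))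
        rw [if_neg this, mul_zero]
      · simp
    · refine Finset.sum_eq_zero fun b _ => ?_
      have : ¬ ((j : ℕ) + 1 = b + 1) := by have := b.2; omega
      rw [if_neg this, mul_zero]
  rw [h0, h1]

theorem vecMul_companion_zero (v α : Fin (d + 1) → ℝ) :
    Matrix.vecMul v (companion α) 0 = v 0 * α 0 + shiftLeft v 0 := vecMul_companion v α 0

theorem eq_zero_of_vecMul_companion_eq_zero {v α : Fin (d + 1) → ℝ} (hα : α (Fin.last d) ≠ 0)
    (h : Matrix.vecMul v (companion α) = 0) : v = 0 := by
  have h0 : v 0 = 0 := by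
    have := congrFun h (Fin.last d)
    rw [vecMul_companion] at this
    simpa [shiftLeft, hα] using this
  funext j
  refine Fin.cases h0 (fun i => ?_) j
  have := congrFun h i.castSucc
  rw [vecMul_companion, h0, shiftLeft, dif_pos (by simp)] at this
  simpa [Fin.succ] using this

theorem measurable_vecMul_companion :
    Measurable fun p : (Fin (d + 1) → ℝ) × (Fin (d + 1) → ℝ) =>
      Matrix.vecMul p.1 (companion p.2) := by
  refine measurable_pi_lambda _ fun j => ?_
  simp only [vecMul_companion]
  refine Measurable.add (Measurable.mul measurable_fst.eval measurable_snd.eval) ?_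
  unfold shiftLeft
  split_ifs
  · exact measurable_fst.eval
  · exact measurable_const

theorem volume_preimage_vecMul_companion_eq_zero_iff {α : Fin (d + 1) → ℝ}
    (hα : α (Fin.last d) ≠ 0) (D : Set (Fin (d + 1) → ℝ)) :
    volume {y | Matrix.vecMul y (companion α) ∈ D} = 0 ↔ volume D = 0 := by
  set f : (Fin (d + 1) → ℝ) →ₗ[ℝ] (Fin (d + 1) → ℝ) := (companion α).vecMulLinear with hf
  have hinj : Function.Injective f := by
    rw [← LinearMap.ker_eq_bot, LinearMap.ker_eq_bot']
    exact fun v hv => eq_zero_of_vecMul_companion_eq_zero hα hv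
  have hdet : LinearMap.det f ≠ 0 := by
    have := (LinearEquiv.ofInjectiveEndo f hinj).isUnit_det'
    exact this.ne_zero
  have h := Measure.addHaar_preimage_linearMap volume hdet D
  have e : {y | Matrix.vecMul y (companion α) ∈ D} = f ⁻¹' D := rfl
  rw [e, h, mul_eq_zero, or_iff_right]
  simpa using hdet

/-- The row vectors `y` from which `D` is reached with positive probability by one multiplication
with a random companion matrix whose first row has law `ρ`. -/
def reach (ρ : Measure (Fin (d + 1) → ℝ)) (D : Set (Fin (d + 1) → ℝ)) : Set (Fin (d + 1) → ℝ) :=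
  {y | 0 < ρ {α | Matrix.vecMul y (companion α) ∈ D}}

/-- The properties of the law of the first row that drive the analysis: its first coordinate has a
law equivalent to Lebesgue measure and can be translated without changing null sets, and its last
coordinate does not vanish. -/
structure IsSpreadRow (ρ : Measure (Fin (d + 1) → ℝ)) : Prop where
  shift : ∀ s : ℝ, Measure.QuasiMeasurePreserving (fun α => α + Pi.single 0 s) ρ ρ
  eval : ∀ E : Set ℝ, MeasurableSet E → (ρ {α | α 0 ∈ E} = 0 ↔ volume E = 0)
  last : ∀ᵐ α ∂ρ, α (Fin.last d) ≠ 0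

variable {ρ : Measure (Fin (d + 1) → ℝ)}

theorem measurableSet_reach [SFinite ρ] {D : Set (Fin (d + 1) → ℝ)} (hD : MeasurableSet D) :
    MeasurableSet (reach ρ D) :=
  (measurable_measure_prodMk_left (measurable_vecMul_companion hD)) measurableSet_Ioi

theorem measurableSet_iterate_reach [SFinite ρ] {D : Set (Fin (d + 1) → ℝ)} (hD : MeasurableSet D)
    (k : ℕ) : MeasurableSet ((reach ρ)^[k] D) := by
  induction k with
  | zero => exact hD
  | succ k ih => rw [Function.iterate_succ_apply']; exact measurableSet_reach ih

/-- A random companion matrix is almost surely invertible, so null sets are preserved. -/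
theorem volume_reach_eq_zero_iff [IsProbabilityMeasure ρ] (hρ : IsSpreadRow ρ)
    {D : Set (Fin (d + 1) → ℝ)} (hD : MeasurableSet D) :
    volume (reach ρ D) = 0 ↔ volume D = 0 := by
  set W : Set ((Fin (d + 1) → ℝ) × (Fin (d + 1) → ℝ)) :=
    (fun p => Matrix.vecMul p.1 (companion p.2)) ⁻¹' D with hW
  have hWm : MeasurableSet W := measurable_vecMul_companion hD
  have h1 : (volume.prod ρ) W = 0 ↔ volume (reach ρ D) = 0 := by
    rw [Measure.measure_prod_null hWm, EventuallyEq, ae_iff]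
    have : {y | ¬ ρ (Prod.mk y ⁻¹' W) = (0 : (Fin (d + 1) → ℝ) → ℝ≥0∞) y} = reach ρ D := by
      ext y
      simp only [Pi.zero_apply, reach, pos_iff_ne_zero]
      rfl
    rw [this]
  have h2 : (volume.prod ρ) W = 0 ↔ ∀ᵐ α ∂ρ, volume {y | Matrix.vecMul y (companion α) ∈ D} = 0 := by
    rw [Measure.prod_apply_symm hWm,
      lintegral_eq_zero_iff (measurable_measure_prodMk_right hWm)]
    rfl
  rw [← h1, h2]
  constructor
  · intro h
    obtain ⟨α, hα, hl⟩ := (h.and hρ.last).exists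
    exact (volume_preimage_vecMul_companion_eq_zero_iff hl D).1 hα
  · intro h
    filter_upwards [hρ.last] with α hl
    exact (volume_preimage_vecMul_companion_eq_zero_iff hl D).2 h

theorem volume_iterate_reach_eq_zero_iff [IsProbabilityMeasure ρ] (hρ : IsSpreadRow ρ)
    {D : Set (Fin (d + 1) → ℝ)} (hD : MeasurableSet D) (k : ℕ) :
    volume ((reach ρ)^[k] D) = 0 ↔ volume D = 0 := by
  induction k with
  | zero => rfl
  | succ k ih =>
    rw [Function.iterate_succ_apply', volume_reach_eq_zero_iff hρ (measurableSet_iterate_reach hD k),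
      ih]

theorem volume_preimage_affine_eq_zero_iff {b : ℝ} (hb : b ≠ 0) (c : ℝ) (E : Set ℝ) :
    volume {t | b * t + c ∈ E} = 0 ↔ volume E = 0 := by
  have e : {t | b * t + c ∈ E} = (fun t => b * t) ⁻¹' ((fun t => t + c) ⁻¹' E) := rfl
  rw [e, Real.volume_preimage_mul_left hb, measure_preimage_add_right, mul_eq_zero, or_iff_right]
  simpa using hb

theorem reach_first_coordinate_iff (hρ : IsSpreadRow ρ) {y : Fin (d + 1) → ℝ} (hy : y 0 ≠ 0)
    {E : Set ℝ} (hE : MeasurableSet E) :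
    ρ {α | Matrix.vecMul y (companion α) 0 ∈ E} = 0 ↔ volume E = 0 := by
  simp only [vecMul_companion_zero]
  have hm : Measurable fun t : ℝ => y 0 * t + shiftLeft y 0 := by fun_prop
  have := hρ.eval _ (hm hE)
  rw [← volume_preimage_affine_eq_zero_iff hy (shiftLeft y 0) E]
  exact this

theorem ae_vecMul_companion_zero_ne_zero (hρ : IsSpreadRow ρ) {y : Fin (d + 1) → ℝ}
    (hy : y 0 ≠ 0) : ∀ᵐ α ∂ρ, Matrix.vecMul y (companion α) 0 ≠ 0 := by
  rw [ae_iff]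
  have := (reach_first_coordinate_iff hρ hy (measurableSet_singleton (0 : ℝ))).2 (by simp)
  simpa using this

/-- Each multiplication smooths out one more coordinate: away from `y 0 = 0`, whether `D` can be
reached from `y` in `k` steps does not depend on the coordinates `1, …, k`. A change of coordinate
`1` is compensated by a translation of the first entry of the random row. -/
theorem mem_iterate_reach_of_eq (hρ : IsSpreadRow ρ) (D : Set (Fin (d + 1) → ℝ)) (k : ℕ) :
    ∀ {y z : Fin (d + 1) → ℝ}, y 0 ≠ 0 → y 0 = z 0 → (∀ j : Fin (d + 1), k < (j : ℕ) → y j = z j) →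
      y ∈ (reach ρ)^[k] D → z ∈ (reach ρ)^[k] D := by
  induction k with
  | zero =>
    intro y z _ h0 h hy
    have : y = z := funext fun j => Fin.cases h0 (fun i => h _ (by simp)) j
    exact this ▸ hy
  | succ k ih =>
    intro y z hy0 h0 h hy
    rw [Function.iterate_succ_apply'] at hy ⊢
    set E := (reach ρ)^[k] D with hE
    set s : ℝ := (shiftLeft y 0 - shiftLeft z 0) / y 0 with hs
    have key : ∀ α : Fin (d + 1) → ℝ, Matrix.vecMul y (companion α) 0 ≠ 0 →
        Matrix.vecMul y (companion α) ∈ E →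
          Matrix.vecMul z (companion (α + Pi.single 0 s)) ∈ E := by
      intro α hα hmem
      refine ih hα ?_ (fun j hj => ?_) hmem
      · rw [vecMul_companion, vecMul_companion, ← h0, Pi.add_apply, Pi.single_eq_same, hs]
        field_simp
        ring
      · have hj0 : j ≠ 0 := by rintro rfl; simp at hj
        rw [vecMul_companion, vecMul_companion, ← h0, Pi.add_apply, Pi.single_eq_of_ne hj0, add_zero]
        congr 1
        unfold shiftLeft
        split_ifs with hlt
        · exact h _ (by simp; omega)
        · rfl
    show 0 < ρ {α | Matrix.vecMul z (companion α) ∈ E}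
    rw [pos_iff_ne_zero]
    intro hz
    have h1 := (hρ.shift s).preimage_null hz
    refine (show 0 < ρ {α | Matrix.vecMul y (companion α) ∈ E} from hy).ne' ?_
    have h2 : ∀ᵐ α ∂ρ, ¬ Matrix.vecMul z (companion (α + Pi.single 0 s)) ∈ E := by
      rw [ae_iff]; simpa using h1
    have h3 : ∀ᵐ α ∂ρ, ¬ Matrix.vecMul y (companion α) ∈ E := by
      filter_upwards [h2, ae_vecMul_companion_zero_ne_zero hρ hy0] with α a1 a2 a3
      exact a1 (key α a2 a3)
    simpa [ae_iff] using h3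

theorem volume_preimage_zero_eq_zero_iff {E : Set ℝ} :
    volume {y : Fin (d + 1) → ℝ | y 0 ∈ E} = 0 ↔ volume E = 0 := by
  constructor
  · intro h
    have h1 : volume (Set.univ.pi fun i : Fin (d + 1) => if i = 0 then E else Set.Icc (0 : ℝ) 1) =
        0 := by
      refine measure_mono_null (fun y hy => ?_) h
      simpa using hy 0 trivial
    rw [volume_pi_pi, Finset.prod_eq_zero_iff] at h1
    obtain ⟨i, -, hi⟩ := h1
    by_cases hi0 : i = 0
    · simpa [hi0] using hi
    · simp [hi0] at hi
  · intro h
    exact (Measure.quasiMeasurePreserving_eval (fun _ : Fin (d + 1) => (volume : Measure ℝ)) 0).preimage_null h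

/-- After `d + 1` steps all coordinates are smoothed out: from any vector with nonvanishing first
coordinate, exactly the sets of positive Lebesgue measure are reached with positive probability. -/
theorem mem_iterate_reach_iff_of_zero_ne_zero [IsProbabilityMeasure ρ] (hρ : IsSpreadRow ρ)
    {D : Set (Fin (d + 1) → ℝ)} (hD : MeasurableSet D) {y : Fin (d + 1) → ℝ} (hy : y 0 ≠ 0) :
    y ∈ (reach ρ)^[d + 1] D ↔ 0 < volume D := by
  set F := (reach ρ)^[d] D with hF
  have hFm : MeasurableSet F := measurableSet_iterate_reach hD d
  set E : Set ℝ := {t | t ≠ 0 ∧ Pi.single (M := fun _ : Fin (d + 1) => ℝ) 0 t ∈ F} with hE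
  have hsm : Measurable fun t : ℝ => Pi.single (M := fun _ : Fin (d + 1) => ℝ) 0 t :=
    measurable_update (0 : Fin (d + 1) → ℝ)
  have hEm : MeasurableSet E := (measurableSet_singleton (0 : ℝ)).compl.inter (hsm hFm)
  have hFE : ∀ v : Fin (d + 1) → ℝ, v 0 ≠ 0 → (v ∈ F ↔ v 0 ∈ E) := by
    intro v hv
    have hj : ∀ j : Fin (d + 1), d < (j : ℕ) →
        v j = Pi.single (M := fun _ : Fin (d + 1) => ℝ) 0 (v 0) j :=
      fun j hj => absurd j.2 (by omega)
    constructor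
    · exact fun h => ⟨hv, mem_iterate_reach_of_eq hρ D d hv (by simp) hj h⟩
    · exact fun h => mem_iterate_reach_of_eq hρ D d (y := Pi.single 0 (v 0)) (by simpa using hv)
        (by simp) (fun j hj' => (hj j hj').symm) h.2
  have h1 : volume F = 0 ↔ volume E = 0 := by
    rw [← volume_preimage_zero_eq_zero_iff (d := d) (E := E)]
    refine Iff.of_eq (congrArg (· = 0) (measure_congr ?_))
    have h0 : ∀ᵐ v : Fin (d + 1) → ℝ, v 0 ≠ 0 := by
      rw [ae_iff]
      simpa using (volume_preimage_zero_eq_zero_iff (d := d) (E := {0})).2 (by simp)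
    filter_upwards [h0] with v hv
    exact propext (hFE v hv)
  have h2 : ρ {α | Matrix.vecMul y (companion α) ∈ F} = 0 ↔ volume E = 0 := by
    rw [← reach_first_coordinate_iff hρ hy hEm]
    refine Iff.of_eq (congrArg (· = 0) (measure_congr ?_))
    filter_upwards [ae_vecMul_companion_zero_ne_zero hρ hy] with α hα
    exact propext (hFE _ hα)
  rw [Function.iterate_succ_apply', ← hF]
  show 0 < ρ {α | Matrix.vecMul y (companion α) ∈ F} ↔ 0 < volume D
  rw [pos_iff_ne_zero, pos_iff_ne_zero, Ne, Ne, h2, ← h1, hF, volume_iterate_reach_eq_zero_iff hρ hD]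

/-- If one of the first `k + 1` coordinates is nonzero, then the first coordinate is nonzero after
`k` further steps, because a vanishing first coordinate leads to a left shift. -/
theorem mem_iterate_reach_iff_of_exists_ne_zero [IsProbabilityMeasure ρ] (hρ : IsSpreadRow ρ)
    {D : Set (Fin (d + 1) → ℝ)} (hD : MeasurableSet D) (k : ℕ) :
    ∀ {y : Fin (d + 1) → ℝ}, (∃ j : Fin (d + 1), (j : ℕ) ≤ k ∧ y j ≠ 0) →
      (y ∈ (reach ρ)^[d + 1 + k] D ↔ 0 < volume D) := by
  induction k with
  | zero =>
    rintro y ⟨j, hj, hy⟩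
    have : j = 0 := Fin.ext (by simpa using hj)
    exact mem_iterate_reach_iff_of_zero_ne_zero hρ hD (this ▸ hy)
  | succ k ih =>
    rintro y ⟨j, hj, hy⟩
    rw [← add_assoc, Function.iterate_succ_apply']
    show 0 < ρ {α | Matrix.vecMul y (companion α) ∈ (reach ρ)^[d + 1 + k] D} ↔ _
    have hae : ∀ᵐ α ∂ρ, (Matrix.vecMul y (companion α) ∈ (reach ρ)^[d + 1 + k] D ↔
        0 < volume D) := by
      by_cases h0 : y 0 = 0
      · refine ae_of_all _ fun α => ih ?_
        have hj0 : (j : ℕ) ≠ 0 := fun h => hy (by rwa [show j = 0 from Fin.ext h])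
        have hjd := j.2
        refine ⟨⟨j - 1, by omega⟩, by simp; omega, ?_⟩
        rw [vecMul_companion, h0, zero_mul, zero_add, shiftLeft, dif_pos (by simp; omega)]
        convert hy using 2
        exact Fin.ext (by simp; omega)
      · filter_upwards [ae_vecMul_companion_zero_ne_zero hρ h0] with α hα
        exact ih ⟨0, by simp, hα⟩
    by_cases hDv : 0 < volume D
    · simp only [hDv, iff_true] at hae ⊢
      have h1 : ρ {α | Matrix.vecMul y (companion α) ∈ (reach ρ)^[d + 1 + k] D} = 1 :=
        (measure_congr (eventuallyEq_univ.2 hae)).trans measure_univ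
      rw [h1]
      exact one_pos
    · simp only [hDv, iff_false] at hae ⊢
      rw [not_lt, nonpos_iff_eq_zero]
      simpa [ae_iff] using hae

theorem mem_iterate_reach_iff [IsProbabilityMeasure ρ] (hρ : IsSpreadRow ρ)
    {D : Set (Fin (d + 1) → ℝ)} (hD : MeasurableSet D) {y : Fin (d + 1) → ℝ} (hy : y ≠ 0) :
    y ∈ (reach ρ)^[d + 1 + d] D ↔ 0 < volume D := by
  obtain ⟨j, hj⟩ := Function.ne_iff.1 hy
  exact mem_iterate_reach_iff_of_exists_ne_zero hρ hD d ⟨j, by omega, hj⟩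

theorem smul_mem_reach_iff {D : Set (Fin (d + 1) → ℝ)}
    (hD : ∀ (c : ℝ) (v : Fin (d + 1) → ℝ), 0 < c → (c • v ∈ D ↔ v ∈ D)) (k : ℕ) :
    ∀ (c : ℝ) (v : Fin (d + 1) → ℝ), 0 < c → (c • v ∈ (reach ρ)^[k] D ↔ v ∈ (reach ρ)^[k] D) := by
  induction k with
  | zero => exact hD
  | succ k ih =>
    intro c v hc
    rw [Function.iterate_succ_apply']
    show 0 < ρ {α | Matrix.vecMul (c • v) (companion α) ∈ _} ↔
      0 < ρ {α | Matrix.vecMul v (companion α) ∈ _}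
    simp only [Matrix.smul_vecMul, ih c _ hc]

end Companion

/-! ### Cones over subsets of the sphere -/

section Cone

variable {q : ℕ}

/-- The cone of all vectors whose direction lies in `B`; it does not contain the origin. -/
def coneOver (B : Set (USphere q)) : Set (Fin q → ℝ) :=
  {v | ‖(WithLp.toLp 2 v : EuclideanSpace ℝ (Fin q))‖⁻¹ •
    (WithLp.toLp 2 v : EuclideanSpace ℝ (Fin q)) ∈ Subtype.val '' B}

theorem measurable_toLp_two : Measurable (WithLp.toLp 2 : (Fin q → ℝ) → EuclideanSpace ℝ (Fin q)) :=
  (PiLp.continuous_toLp 2 _).measurable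

theorem measurableSet_coneOver {B : Set (USphere q)} (hB : MeasurableSet B) :
    MeasurableSet (coneOver B) := by
  have h1 : MeasurableSet (Subtype.val '' B : Set (EuclideanSpace ℝ (Fin q))) :=
    MeasurableSet.subtype_image Metric.isClosed_sphere.measurableSet hB
  have h2 : Measurable fun v : Fin q → ℝ => ‖(WithLp.toLp 2 v : EuclideanSpace ℝ (Fin q))‖⁻¹ •
      (WithLp.toLp 2 v : EuclideanSpace ℝ (Fin q)) :=
    (measurable_toLp_two.norm.inv).smul measurable_toLp_two
  exact h2 h1

theorem smul_mem_coneOver_iff (B : Set (USphere q)) (c : ℝ) (v : Fin q → ℝ) (hc : 0 < c) :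
    c • v ∈ coneOver B ↔ v ∈ coneOver B := by
  have h : ‖(WithLp.toLp 2 (c • v) : EuclideanSpace ℝ (Fin q))‖⁻¹ •
      (WithLp.toLp 2 (c • v) : EuclideanSpace ℝ (Fin q)) =
      ‖(WithLp.toLp 2 v : EuclideanSpace ℝ (Fin q))‖⁻¹ •
        (WithLp.toLp 2 v : EuclideanSpace ℝ (Fin q)) := by
    rw [WithLp.toLp_smul, norm_smul, Real.norm_of_nonneg hc.le, smul_smul, mul_inv,
      mul_right_comm, inv_mul_cancel₀ hc.ne', one_mul]
  show _ ∈ Subtype.val '' B ↔ _ ∈ Subtype.val '' B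
  rw [h]

theorem ofLp_mem_coneOver_iff (B : Set (USphere q)) (x : USphere q) :
    (x : EuclideanSpace ℝ (Fin q)).ofLp ∈ coneOver B ↔ x ∈ B := by
  have hx : ‖(x : EuclideanSpace ℝ (Fin q))‖ = 1 := mem_sphere_zero_iff_norm.1 x.2
  show _ ∈ Subtype.val '' B ↔ _
  rw [WithLp.toLp_ofLp, hx, inv_one, one_smul]
  exact Subtype.val_injective.mem_set_image

theorem coe_dirStep_of_ne_zero {x : USphere q} {A : Matrix (Fin q) (Fin q) ℝ}
    (h : rowMul (x : EuclideanSpace ℝ (Fin q)) A ≠ 0) :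
    (dirStep x A : EuclideanSpace ℝ (Fin q)) =
      ‖rowMul (x : EuclideanSpace ℝ (Fin q)) A‖⁻¹ • rowMul (x : EuclideanSpace ℝ (Fin q)) A := by
  rw [dirStep, dif_neg h]

theorem ofLp_dirStep_mem_iff {x : USphere q} {A : Matrix (Fin q) (Fin q) ℝ}
    (h : rowMul (x : EuclideanSpace ℝ (Fin q)) A ≠ 0) {D : Set (Fin q → ℝ)}
    (hD : ∀ (c : ℝ) (v : Fin q → ℝ), 0 < c → (c • v ∈ D ↔ v ∈ D)) :
    (dirStep x A : EuclideanSpace ℝ (Fin q)).ofLp ∈ D ↔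
      Matrix.vecMul (x : EuclideanSpace ℝ (Fin q)).ofLp A ∈ D := by
  rw [coe_dirStep_of_ne_zero h, WithLp.ofLp_smul]
  exact hD _ _ (inv_pos.2 (norm_pos_iff.2 h))

open scoped Pointwise in
/-- The surface measure of a set vanishes exactly when the cone over it is a null set: the cone is
a countable union of dilations of its part in the unit ball. -/
theorem volume_coneOver_eq_zero_iff [NeZero q] {B : Set (USphere q)} (hB : MeasurableSet B) :
    volume (coneOver B) = 0 ↔ sphereLebesgue q B = 0 := by
  set V : Set (EuclideanSpace ℝ (Fin q)) := Set.Ioo (0 : ℝ) 1 • (Subtype.val '' B) with hV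
  have h1 : sphereLebesgue q B = 0 ↔ volume V = 0 := by
    rw [sphereLebesgue, Measure.toSphere_apply' _ hB, mul_eq_zero, or_iff_right]
    simpa using NeZero.ne q
  have h2 : volume (coneOver B) = volume (WithLp.ofLp ⁻¹' coneOver B :
      Set (EuclideanSpace ℝ (Fin q))) :=
    ((PiLp.volume_preserving_ofLp (Fin q)).measure_preimage
      (measurableSet_coneOver hB).nullMeasurableSet).symm
  have hmem : ∀ v : EuclideanSpace ℝ (Fin q), v.ofLp ∈ coneOver B ↔
      ‖v‖⁻¹ • v ∈ (Subtype.val '' B : Set (EuclideanSpace ℝ (Fin q))) := fun v => Iff.rfl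
  rw [h1, h2]
  constructor
  · refine fun h => measure_mono_null ?_ h
    rintro _ ⟨c, hc, _, ⟨x, hx, rfl⟩, rfl⟩
    show (c • (x : EuclideanSpace ℝ (Fin q))).ofLp ∈ coneOver B
    rw [WithLp.ofLp_smul]
    exact (smul_mem_coneOver_iff B c _ hc.1).2 ((ofLp_mem_coneOver_iff B x).2 hx)
  · intro h
    have hsub : (WithLp.ofLp ⁻¹' coneOver B : Set (EuclideanSpace ℝ (Fin q))) ⊆
        ⋃ n : ℕ, ((n : ℝ) + 1) • V := by
      intro v hv
      have hv1 := (hmem v).1 hv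
      have hv0 : v ≠ 0 := by
        rintro rfl
        obtain ⟨y, -, hy⟩ := hv1
        have := mem_sphere_zero_iff_norm.1 y.2
        rw [hy] at this
        simp at this
      have hn0 : 0 < ‖v‖ := norm_pos_iff.2 hv0
      obtain ⟨n, hn⟩ := exists_nat_gt ‖v‖
      have hn1 : (0 : ℝ) < (n : ℝ) + 1 := by positivity
      refine Set.mem_iUnion.2 ⟨n, ((n : ℝ) + 1)⁻¹ • v, ⟨((n : ℝ) + 1)⁻¹ * ‖v‖, ⟨by positivity, ?_⟩,
        ‖v‖⁻¹ • v, hv1, ?_⟩, ?_⟩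
      · rw [inv_mul_lt_one₀ hn1]; linarith
      · simp only [smul_smul]
        rw [mul_assoc, mul_inv_cancel₀ hn0.ne', mul_one]
      · simp only [smul_smul]
        rw [mul_inv_cancel₀ hn1.ne', one_smul]
    refine measure_mono_null hsub (measure_iUnion_null fun n => ?_)
    rw [Measure.addHaar_smul, h, mul_zero]

theorem Measurable.tiltWeight {β : Type*} [MeasurableSpace β] {l : ℝ} {h : C(USphere q, ℝ)}
    {f : β → USphere q} {g : β → Fin q → ℝ} (hf : Measurable f) (hg : Measurable g) :
    Measurable fun b => tiltWeight l h (f b) (g b) := by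
  have h1 := (measurable_tiltWeight l h).comp (hf.prodMk hg)
  exact h1

theorem Measurable.dirStep_companion {β : Type*} [MeasurableSpace β]
    {f : β → USphere q} {g : β → Fin q → ℝ} (hf : Measurable f) (hg : Measurable g) :
    Measurable fun b => dirStep (f b) (companion (g b)) := by
  have h1 := measurable_dirStep_companion.comp (hf.prodMk hg)
  exact h1

theorem measurable_tiltWeight_right {l : ℝ} {h : C(USphere q, ℝ)} (x : USphere q) :
    Measurable fun α : Fin q → ℝ => tiltWeight l h x α :=
  measurable_const.tiltWeight measurable_id

end Cone

/-! ### The tilted kernel -/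

section Tilted

variable {d : ℕ} {ρ : Measure (Fin (d + 1) → ℝ)} {l : ℝ} {h : C(USphere (d + 1), ℝ)}

theorem measurable_dirStep_right (x : USphere (d + 1)) :
    Measurable fun α : Fin (d + 1) → ℝ => dirStep x (companion α) :=
  measurable_const.dirStep_companion measurable_id

theorem tiltedKernel_apply [SFinite ρ] (x : USphere (d + 1)) :
    tiltedKernel ρ l h x = (ρ.withDensity fun α => ENNReal.ofReal (tiltWeight l h x α)).map
      (fun α => dirStep x (companion α)) := rfl

theorem lintegral_tiltedKernel [SFinite ρ] (x : USphere (d + 1)) {g : USphere (d + 1) → ℝ≥0∞}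
    (hg : Measurable g) :
    ∫⁻ y, g y ∂(tiltedKernel ρ l h x) =
      ∫⁻ α, ENNReal.ofReal (tiltWeight l h x α) * g (dirStep x (companion α)) ∂ρ := by
  have hg' : Measurable fun α : Fin (d + 1) → ℝ => g (dirStep x (companion α)) :=
    hg.comp (measurable_dirStep_right x)
  rw [tiltedKernel_apply, lintegral_map hg (measurable_dirStep_right x),
    lintegral_withDensity_eq_lintegral_mul _ (measurable_tiltWeight_right x).ennreal_ofReal hg']
  rfl

theorem tiltWeight_nonneg (hpos : ∀ x, 0 < h x) (x : USphere (d + 1)) (α : Fin (d + 1) → ℝ) :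
    0 ≤ tiltWeight l h x α :=
  div_nonneg (mul_nonneg (Real.rpow_nonneg (norm_nonneg _) _) (hpos _).le) (hpos x).le

theorem coe_sphere_ofLp_ne_zero (x : USphere (d + 1)) :
    (x : EuclideanSpace ℝ (Fin (d + 1))).ofLp ≠ 0 := by
  intro h0
  have := mem_sphere_zero_iff_norm.1 x.2
  rw [show (x : EuclideanSpace ℝ (Fin (d + 1))) = 0 from by ext i; exact congrFun h0 i] at this
  simp at this

theorem rowMul_companion_ne_zero {α : Fin (d + 1) → ℝ} (hα : α (Fin.last d) ≠ 0)
    (x : USphere (d + 1)) : rowMul (x : EuclideanSpace ℝ (Fin (d + 1))) (companion α) ≠ 0 := by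
  intro h0
  exact coe_sphere_ofLp_ne_zero x (eq_zero_of_vecMul_companion_eq_zero hα
    (congrArg WithLp.ofLp h0))

theorem tiltWeight_pos (hpos : ∀ x, 0 < h x) {α : Fin (d + 1) → ℝ} (hα : α (Fin.last d) ≠ 0)
    (x : USphere (d + 1)) : 0 < tiltWeight l h x α :=
  div_pos (mul_pos (Real.rpow_pos_of_pos (norm_pos_iff.2 (rowMul_companion_ne_zero hα x)) _)
    (hpos _)) (hpos x)

theorem tiltedKernel_apply_eq_zero_iff [SFinite ρ] (hρ : IsSpreadRow ρ) (hpos : ∀ x, 0 < h x)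
    (x : USphere (d + 1)) {B : Set (USphere (d + 1))} (hB : MeasurableSet B) :
    tiltedKernel ρ l h x B = 0 ↔ ρ {α | dirStep x (companion α) ∈ B} = 0 := by
  rw [tiltedKernel_apply, Measure.map_apply (measurable_dirStep_right x) hB,
    withDensity_apply_eq_zero (measurable_tiltWeight_right x).ennreal_ofReal]
  refine Iff.of_eq (congrArg (· = 0) (measure_congr ?_))
  filter_upwards [hρ.last] with α hα
  have h1 : ENNReal.ofReal (tiltWeight l h x α) ≠ 0 := by
    simpa using tiltWeight_pos hpos hα x
  exact propext ⟨fun hh => hh.2, fun hh => ⟨h1, hh⟩⟩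

/-- A set can be reached by the chain in `n` steps exactly when the cone over it can be reached
by the products of `n` random companion matrices; the weights of the change of measure do not
matter, because they are almost surely positive. -/
theorem tiltedKernel_pow_apply_eq_zero_iff [SFinite ρ] (hρ : IsSpreadRow ρ) (hpos : ∀ x, 0 < h x)
    {B : Set (USphere (d + 1))} (hB : MeasurableSet B) (n : ℕ) (x : USphere (d + 1)) :
    ((tiltedKernel ρ l h) ^ n) x B = 0 ↔
      (x : EuclideanSpace ℝ (Fin (d + 1))).ofLp ∉ (reach ρ)^[n] (coneOver B) := by
  induction n generalizing x with
  | zero =>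
    have h0 : (tiltedKernel ρ l h) ^ 0 = Kernel.id := pow_zero _
    rw [h0, Kernel.id_apply, Measure.dirac_apply' _ hB, Function.iterate_zero, id_eq,
      ofLp_mem_coneOver_iff]
    by_cases hx : x ∈ B <;> simp [hx]
  | succ n ih =>
    set E := (reach ρ)^[n] (coneOver B) with hE
    have hEm : MeasurableSet E := measurableSet_iterate_reach (measurableSet_coneOver hB) n
    have hEs := smul_mem_reach_iff (ρ := ρ) (smul_mem_coneOver_iff B) n
    have hset : MeasurableSet {y : USphere (d + 1) |
        (y : EuclideanSpace ℝ (Fin (d + 1))).ofLp ∈ E} :=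
      ((PiLp.continuous_ofLp 2 _).measurable.comp measurable_subtype_coe) hEm
    have h1 : (tiltedKernel ρ l h) ^ (n + 1) =
        ((tiltedKernel ρ l h) ^ n) ∘ₖ (tiltedKernel ρ l h) := pow_succ _ n
    rw [h1, Kernel.comp_apply' _ _ _ hB, lintegral_eq_zero_iff (Kernel.measurable_coe _ hB),
      Function.iterate_succ_apply', ← hE]
    have h2 : ((fun y => ((tiltedKernel ρ l h) ^ n) y B) =ᵐ[tiltedKernel ρ l h x] 0) ↔
        tiltedKernel ρ l h x {y | (y : EuclideanSpace ℝ (Fin (d + 1))).ofLp ∈ E} = 0 := by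
      rw [measure_eq_zero_iff_ae_notMem]
      refine eventually_congr (ae_of_all _ fun y => ?_)
      exact ih y
    have h3 : ρ {α | dirStep x (companion α) ∈
        {y : USphere (d + 1) | (y : EuclideanSpace ℝ (Fin (d + 1))).ofLp ∈ E}} =
        ρ {α | Matrix.vecMul (x : EuclideanSpace ℝ (Fin (d + 1))).ofLp (companion α) ∈ E} := by
      refine measure_congr ?_
      filter_upwards [hρ.last] with α hα
      exact propext (ofLp_dirStep_mem_iff (rowMul_companion_ne_zero hα x) hEs)
    rw [h2, tiltedKernel_apply_eq_zero_iff hρ hpos x hset, h3]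
    show _ ↔ ¬ (0 < ρ {α | Matrix.vecMul (x : EuclideanSpace ℝ (Fin (d + 1))).ofLp
      (companion α) ∈ E})
    rw [not_lt, nonpos_iff_eq_zero]

theorem tiltedKernel_pow_apply_eq_zero_iff_sphereLebesgue [IsProbabilityMeasure ρ]
    (hρ : IsSpreadRow ρ) (hpos : ∀ x, 0 < h x) {B : Set (USphere (d + 1))} (hB : MeasurableSet B)
    (x : USphere (d + 1)) :
    ((tiltedKernel ρ l h) ^ (d + 1 + d)) x B = 0 ↔ sphereLebesgue (d + 1) B = 0 := by
  rw [tiltedKernel_pow_apply_eq_zero_iff hρ hpos hB,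
    mem_iterate_reach_iff hρ (measurableSet_coneOver hB) (coe_sphere_ofLp_ne_zero x), not_lt,
    nonpos_iff_eq_zero, volume_coneOver_eq_zero_iff hB]

/-- The bound `|x' A| ≤ ∑ (|α_j| + 1)` for unit vectors `x`. -/
theorem norm_rowMul_companion_le (x : USphere (d + 1)) (α : Fin (d + 1) → ℝ) :
    ‖rowMul (x : EuclideanSpace ℝ (Fin (d + 1))) (companion α)‖ ≤ ∑ j, (|α j| + 1) := by
  have hx : ∀ i, |(x : EuclideanSpace ℝ (Fin (d + 1))).ofLp i| ≤ 1 := fun i => by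
    have := PiLp.norm_apply_le (x : EuclideanSpace ℝ (Fin (d + 1))) i
    rwa [mem_sphere_zero_iff_norm.1 x.2] at this
  have hs : ∀ j, |shiftLeft (x : EuclideanSpace ℝ (Fin (d + 1))).ofLp j| ≤ 1 := fun j => by
    unfold shiftLeft
    split_ifs
    · exact hx _
    · simp
  refine abs_le_of_sq_le_sq' ?_ (by positivity) |>.2
  rw [EuclideanSpace.norm_sq_eq]
  refine le_trans (Finset.sum_le_sum fun j _ => ?_)
    (Finset.sum_sq_le_sq_sum_of_nonneg (s := Finset.univ) (f := fun j => |α j| + 1) fun _ _ => by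
      positivity)
  refine pow_le_pow_left₀ (norm_nonneg _) ?_ 2
  show |Matrix.vecMul (x : EuclideanSpace ℝ (Fin (d + 1))).ofLp (companion α) j| ≤ _
  rw [vecMul_companion]
  refine (abs_add_le _ _).trans (add_le_add ?_ (hs j))
  rw [abs_mul]
  exact mul_le_of_le_one_left (abs_nonneg _) (hx 0)

theorem one_le_sum_abs_add_one (α : Fin (d + 1) → ℝ) : 1 ≤ ∑ j, (|α j| + 1) := by
  have := Finset.single_le_sum (f := fun j => |α j| + 1) (fun j _ => by positivity)
    (Finset.mem_univ (0 : Fin (d + 1)))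
  have h0 := abs_nonneg (α 0)
  linarith

theorem integrable_sum_abs_rpow [IsProbabilityMeasure ρ]
    (hmom : ∀ (k : ℕ) i, Integrable (fun α => |α i| ^ k) ρ) (l : ℝ) :
    Integrable (fun α : Fin (d + 1) → ℝ => (∑ j, (|α j| + 1)) ^ l) ρ := by
  obtain ⟨k, hk⟩ := exists_nat_ge l
  have hmeas : Measurable fun α : Fin (d + 1) → ℝ => ∑ j, (|α j| + 1) := by
    refine Finset.measurable_sum _ fun j _ => ?_
    exact (measurable_norm.comp (measurable_pi_apply j)).add_const 1
  have hint : Integrable (fun α : Fin (d + 1) → ℝ => (∑ j, (|α j| + 1)) ^ (k + 1)) ρ := by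
    have h1 : MemLp (fun α : Fin (d + 1) → ℝ => ∑ j, (|α j| + 1)) ((k + 1 : ℕ) : ℝ≥0∞) ρ := by
      refine memLp_finsetSum _ fun j _ => ?_
      refine MemLp.add ?_ (memLp_const 1)
      refine (integrable_norm_rpow_iff (measurable_norm.comp
        (measurable_pi_apply j)).aestronglyMeasurable (by simp) (ENNReal.natCast_ne_top _)).1 ?_
      have hk1 : ((k + 1 : ℕ) : ℝ≥0∞).toReal = ((k + 1 : ℕ) : ℝ) := ENNReal.toReal_natCast _
      simpa only [hk1, Real.rpow_natCast, Function.comp_apply, Real.norm_eq_abs, abs_abs] using hmom (k + 1) j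
    have h3 := h1.integrable_norm_pow (Nat.succ_ne_zero k)
    refine h3.congr (ae_of_all _ fun α => ?_)
    simp only
    rw [Real.norm_of_nonneg (zero_le_one.trans (one_le_sum_abs_add_one α))]
  refine hint.mono (hmeas.pow_const l).aestronglyMeasurable (ae_of_all _ fun α => ?_)
  have h1 := one_le_sum_abs_add_one α
  rw [Real.norm_of_nonneg (Real.rpow_nonneg (zero_le_one.trans h1) _),
    Real.norm_of_nonneg (pow_nonneg (zero_le_one.trans h1) _), ← Real.rpow_natCast]
  exact Real.rpow_le_rpow_of_exponent_le h1 (by push_cast; linarith)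

end Tilted

/-! ### Ergodicity of the tilted kernel -/

section TiltedErgodic

variable {d : ℕ} {ρ : Measure (Fin (d + 1) → ℝ)} {l : ℝ} {h : C(USphere (d + 1), ℝ)}

theorem tiltWeight_le (hl : 0 ≤ l) (hpos : ∀ x, 0 < h x) {c : ℝ} (hc : 0 < c) (hch : ∀ x, c ≤ h x)
    (x : USphere (d + 1)) (α : Fin (d + 1) → ℝ) :
    tiltWeight l h x α ≤ (∑ j, (|α j| + 1)) ^ l * (‖h‖ / c) := by
  rw [tiltWeight, mul_div_assoc]
  refine mul_le_mul (Real.rpow_le_rpow (norm_nonneg _) (norm_rowMul_companion_le x α) hl)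
    (div_le_div₀ (norm_nonneg _) ?_ hc (hch x)) (div_nonneg (hpos _).le (hpos _).le)
    (Real.rpow_nonneg (zero_le_one.trans (one_le_sum_abs_add_one α)) _)
  exact (le_abs_self _).trans (h.norm_coe_le_norm _)

theorem exists_pos_le (hpos : ∀ x, 0 < h x) : ∃ c, 0 < c ∧ ∀ x, c ≤ h x := by
  rcases isEmpty_or_nonempty (USphere (d + 1)) with he | hne
  · exact ⟨1, one_pos, fun x => he.elim x⟩
  · obtain ⟨x, -, hx⟩ := isCompact_univ.exists_isMinOn Set.univ_nonempty h.continuous.continuousOn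
    exact ⟨h x, hpos x, fun y => hx (Set.mem_univ y)⟩

theorem integrable_tiltWeight [IsProbabilityMeasure ρ] (hl : 0 ≤ l) (hpos : ∀ x, 0 < h x)
    (hmom : ∀ (k : ℕ) i, Integrable (fun α => |α i| ^ k) ρ) (x : USphere (d + 1)) :
    Integrable (fun α => tiltWeight l h x α) ρ := by
  obtain ⟨c, hc, hch⟩ := exists_pos_le hpos
  refine ((integrable_sum_abs_rpow hmom l).mul_const (‖h‖ / c)).mono'
    (measurable_tiltWeight_right x).aestronglyMeasurable (ae_of_all _ fun α => ?_)
  rw [Real.norm_of_nonneg (tiltWeight_nonneg hpos x α)]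
  exact tiltWeight_le hl hpos hc hch x α

theorem isMarkovKernel_tiltedKernel [IsProbabilityMeasure ρ] (hl : 0 ≤ l) (hpos : ∀ x, 0 < h x)
    (hmom : ∀ (k : ℕ) i, Integrable (fun α => |α i| ^ k) ρ)
    (heig : ∀ x, ∫ α, tiltWeight l h x α ∂ρ = 1) : IsMarkovKernel (tiltedKernel ρ l h) := by
  refine ⟨fun x => ⟨?_⟩⟩
  have h1 := lintegral_tiltedKernel (ρ := ρ) (l := l) (h := h) x
    (g := fun _ => 1) measurable_const
  simp only [lintegral_const, one_mul, mul_one] at h1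
  rw [h1, ← ofReal_integral_eq_lintegral_ofReal (integrable_tiltWeight hl hpos hmom x)
    (ae_of_all _ (tiltWeight_nonneg hpos x)), heig, ENNReal.ofReal_one]

theorem integral_tiltedKernel [SFinite ρ] (hpos : ∀ x, 0 < h x) (x : USphere (d + 1))
    {f : USphere (d + 1) → ℝ} (hf : Measurable f) :
    ∫ y, f y ∂(tiltedKernel ρ l h x) =
      ∫ α, tiltWeight l h x α * f (dirStep x (companion α)) ∂ρ := by
  rw [tiltedKernel_apply, integral_map (measurable_dirStep_right x).aemeasurable
    hf.aestronglyMeasurable, integral_withDensity_eq_integral_toReal_smul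
      (measurable_tiltWeight_right x).ennreal_ofReal (ae_of_all _ fun _ => ENNReal.ofReal_lt_top)]
  refine integral_congr_ae (ae_of_all _ fun α => ?_)
  simp only [smul_eq_mul, ENNReal.toReal_ofReal (tiltWeight_nonneg hpos x α)]

theorem continuous_rowMul_companion (α : Fin (d + 1) → ℝ) :
    Continuous fun x : USphere (d + 1) =>
      rowMul (x : EuclideanSpace ℝ (Fin (d + 1))) (companion α) := by
  refine (PiLp.continuous_toLp 2 _).comp ?_
  have h1 : Continuous fun x : USphere (d + 1) => (x : EuclideanSpace ℝ (Fin (d + 1))).ofLp :=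
    (PiLp.continuous_ofLp 2 _).comp continuous_subtype_val
  exact h1.matrix_vecMul continuous_const

theorem continuous_dirStep_companion {α : Fin (d + 1) → ℝ} (hα : α (Fin.last d) ≠ 0) :
    Continuous fun x : USphere (d + 1) => dirStep x (companion α) := by
  rw [continuous_induced_rng]
  have h1 : (Subtype.val ∘ fun x : USphere (d + 1) => dirStep x (companion α)) =
      fun x : USphere (d + 1) => ‖rowMul (x : EuclideanSpace ℝ (Fin (d + 1))) (companion α)‖⁻¹ •
        rowMul (x : EuclideanSpace ℝ (Fin (d + 1))) (companion α) :=
    funext fun x => coe_dirStep_of_ne_zero (rowMul_companion_ne_zero hα x)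
  rw [h1]
  have h2 := continuous_rowMul_companion α
  exact (h2.norm.inv₀ fun x => norm_ne_zero_iff.2 (rowMul_companion_ne_zero hα x)).smul h2

theorem isFeller_tiltedKernel [IsProbabilityMeasure ρ] (hρ : IsSpreadRow ρ) (hl : 0 ≤ l)
    (hpos : ∀ x, 0 < h x) (hmom : ∀ (k : ℕ) i, Integrable (fun α => |α i| ^ k) ρ) :
    IsFeller (tiltedKernel ρ l h) := by
  intro f
  obtain ⟨c, hc, hch⟩ := exists_pos_le hpos
  simp only [integral_tiltedKernel hpos _ f.continuous.measurable]
  refine continuous_of_dominated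
    (bound := fun α => (∑ j, (|α j| + 1)) ^ l * (‖h‖ / c) * ‖f‖) (fun x => ?_) (fun x => ?_) ?_ ?_
  · exact ((measurable_tiltWeight_right x).mul
      (f.continuous.measurable.comp (measurable_dirStep_right x))).aestronglyMeasurable
  · refine ae_of_all _ fun α => ?_
    rw [norm_mul, Real.norm_of_nonneg (tiltWeight_nonneg hpos x α)]
    exact mul_le_mul (tiltWeight_le hl hpos hc hch x α) (f.norm_coe_le_norm _) (norm_nonneg _)
      ((tiltWeight_nonneg hpos x α).trans (tiltWeight_le hl hpos hc hch x α))
  · exact ((integrable_sum_abs_rpow hmom l).mul_const _).mul_const _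
  · filter_upwards [hρ.last] with α hα
    have h1 := continuous_dirStep_companion hα
    refine Continuous.mul (Continuous.div₀ (Continuous.mul ?_ (h.continuous.comp h1))
      h.continuous fun x => (hpos x).ne') (f.continuous.comp h1)
    exact (continuous_rowMul_companion α).norm.rpow_const fun x => Or.inr hl

instance sphereLebesgue.instIsFiniteMeasure (q : ℕ) : IsFiniteMeasure (sphereLebesgue q) := by
  unfold sphereLebesgue
  infer_instance

instance sphereLebesgue.instIsOpenPosMeasure (q : ℕ) : (sphereLebesgue q).IsOpenPosMeasure := by
  unfold sphereLebesgue
  infer_instance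

theorem tiltedKernel_ergodic [IsProbabilityMeasure ρ] (hρ : IsSpreadRow ρ) (hl : 0 ≤ l)
    (hpos : ∀ x, 0 < h x) (hmom : ∀ (k : ℕ) i, Integrable (fun α => |α i| ^ k) ρ)
    [IsMarkovKernel (tiltedKernel ρ l h)] :
    IsPositiveHarrisRecurrent (tiltedKernel ρ l h) ∧
      ∃ π : Measure (USphere (d + 1)), IsProbabilityMeasure π ∧
        Kernel.Invariant (tiltedKernel ρ l h) π ∧
        IsUniformlyGeometricallyErgodic (tiltedKernel ρ l h) π ∧
        π ≪ sphereLebesgue (d + 1) ∧ sphereLebesgue (d + 1) ≪ π := by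
  have hne : Nonempty (USphere (d + 1)) := by
    obtain ⟨x, hx⟩ := NormedSpace.sphere_nonempty (E := EuclideanSpace ℝ (Fin (d + 1)))
      (x := 0) (r := 1) |>.2 zero_le_one
    exact ⟨⟨x, hx⟩⟩
  exact (isFeller_tiltedKernel hρ hl hpos hmom).ergodic (N := d + 1 + d) (by omega)
    fun x {B} hB => tiltedKernel_pow_apply_eq_zero_iff_sphereLebesgue hρ hpos hB x

end TiltedErgodic

/-! ### The law of the random coefficients -/

section CoeffLaw

variable {Ω : Type*} [MeasurableSpace Ω] {P : Measure Ω}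

variable {q : ℕ} {a σ : Fin q → ℝ} {η : ℕ → Fin q → Ω → ℝ} {φ : ℝ → ℝ}

theorem measurable_coeff (hD1 : CondD1 P η φ) (n : ℕ) : Measurable (coeff a σ η n) :=
  measurable_pi_lambda _ fun i => ((hD1.measurable n i).const_mul _).const_add _

theorem map_coeff_eq_pi [IsProbabilityMeasure P] (hD1 : CondD1 P η φ) (n : ℕ) :
    P.map (coeff a σ η n) = Measure.pi fun i =>
      (volume.withDensity fun t => ENNReal.ofReal (φ t)).map fun t => a i + σ i * t := by
  have h1 : iIndepFun (fun i : Fin q => η n i) P :=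
    hD1.indep.precomp (g := fun i : Fin q => (n, i)) fun i j hij => (Prod.mk.inj hij).2
  have h2 : iIndepFun (fun (i : Fin q) (ω : Ω) => a i + σ i * η n i ω) P :=
    h1.comp (fun i t => a i + σ i * t) fun i => by fun_prop
  have h3 := (iIndepFun_iff_map_fun_eq_pi_map fun i =>
    ((hD1.measurable n i).const_mul (σ i)).const_add (a i) |>.aemeasurable).1 h2
  refine h3.trans (congrArg Measure.pi (funext fun i => ?_))
  rw [← hD1.law n i, Measure.map_map (by fun_prop) (hD1.measurable n i)]
  rfl

theorem map_coeff_eq_coeffLaw [IsProbabilityMeasure P] (hD1 : CondD1 P η φ) (n : ℕ) :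
    P.map (coeff a σ η n) = coeffLaw P a σ η := by
  rw [coeffLaw, map_coeff_eq_pi hD1, map_coeff_eq_pi hD1]

theorem isProbabilityMeasure_coeffLaw [IsProbabilityMeasure P] (hD1 : CondD1 P η φ) :
    IsProbabilityMeasure (coeffLaw P a σ η) :=
  Measure.isProbabilityMeasure_map (measurable_coeff hD1 0).aemeasurable

theorem density_apply_eq_zero_iff (hD1 : CondD1 P η φ) (E : Set ℝ) :
    (volume.withDensity fun t => ENNReal.ofReal (φ t)) E = 0 ↔ volume E = 0 := by
  have hm : Measurable fun t => ENNReal.ofReal (φ t) := hD1.continuous.measurable.ennreal_ofReal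
  have hne : ∀ t, ENNReal.ofReal (φ t) ≠ 0 := fun t => by simpa using hD1.pos t
  rw [withDensity_apply_eq_zero hm]
  simp [hne]

theorem affine_density_apply_eq_zero_iff (hD1 : CondD1 P η φ) (b : ℝ) {s : ℝ} (hs : s ≠ 0)
    {E : Set ℝ} (hE : MeasurableSet E) :
    (volume.withDensity fun t => ENNReal.ofReal (φ t)).map (fun t => b + s * t) E = 0 ↔
      volume E = 0 := by
  rw [Measure.map_apply (by fun_prop) hE, density_apply_eq_zero_iff hD1,
    ← volume_preimage_affine_eq_zero_iff hs b E]
  simp only [add_comm b]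
  rfl

theorem integrable_abs_pow_coeffLaw [IsProbabilityMeasure P] (hD1 : CondD1 P η φ) (k : ℕ) (i : Fin q) :
    Integrable (fun α : Fin q → ℝ => |α i| ^ k) (coeffLaw P a σ η) := by
  have hm : Measurable fun α : Fin q → ℝ => |α i| ^ k :=
    (measurable_norm.comp (measurable_pi_apply i)).pow_const k
  rw [coeffLaw, integrable_map_measure hm.aestronglyMeasurable (measurable_coeff hD1 0).aemeasurable]
  rcases Nat.eq_zero_or_pos k with rfl | hk
  · simp [Function.comp_def]
  have h1 : MemLp (η 0 i) (k : ℝ≥0∞) P := by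
    refine (integrable_norm_rpow_iff (hD1.measurable 0 i).aestronglyMeasurable
      (by simpa using hk.ne') (ENNReal.natCast_ne_top _)).1 ?_
    simpa only [ENNReal.toReal_natCast, Real.rpow_natCast, Real.norm_eq_abs] using hD1.moments 0 i k
  have h2 : MemLp (fun ω => a i + σ i * η 0 i ω) (k : ℝ≥0∞) P :=
    (memLp_const (a i)).add (h1.const_mul (σ i))
  exact h2.integrable_norm_pow hk.ne'

theorem isSpreadRow_coeffLaw [IsProbabilityMeasure P] {d : ℕ} {a σ : Fin (d + 1) → ℝ} {η : ℕ → Fin (d + 1) → Ω → ℝ}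
    (hD1 : CondD1 P η φ) (h0 : σ 0 ≠ 0) (hlast : σ (Fin.last d) ≠ 0 ∨ a (Fin.last d) ≠ 0) :
    IsSpreadRow (coeffLaw P a σ η) := by
  set μ : Fin (d + 1) → Measure ℝ := fun i =>
    (volume.withDensity fun t => ENNReal.ofReal (φ t)).map fun t => a i + σ i * t with hμ
  have hρ : coeffLaw P a σ η = Measure.pi μ := map_coeff_eq_pi hD1 0
  have hpd : IsProbabilityMeasure (volume.withDensity fun t => ENNReal.ofReal (φ t)) := by
    rw [← hD1.law 0 0]
    exact Measure.isProbabilityMeasure_map (hD1.measurable 0 0).aemeasurable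
  have hpμ : ∀ i, IsProbabilityMeasure (μ i) := fun i =>
    Measure.isProbabilityMeasure_map (by fun_prop)
  have heval : ∀ i, ∀ E : Set ℝ, MeasurableSet E → coeffLaw P a σ η {α | α i ∈ E} = μ i E := by
    intro i E hE
    rw [hρ, ← (measurePreserving_eval μ i).measure_preimage hE.nullMeasurableSet]
    rfl
  have hμ0 : ∀ E, MeasurableSet E → (μ 0 E = 0 ↔ volume E = 0) := fun E hE =>
    affine_density_apply_eq_zero_iff hD1 (a 0) h0 hE
  refine ⟨fun s => ?_, fun E hE => ?_, ?_⟩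
  · -- split off the coordinate `0`; its law is equivalent to the translation invariant `volume`
    have hq0 : Measure.QuasiMeasurePreserving (fun t : ℝ => t + s) (μ 0) (μ 0) := by
      refine ⟨measurable_add_const s, Measure.AbsolutelyContinuous.mk fun E hE h => ?_⟩
      have hm : Measurable fun t : ℝ => t + s := measurable_add_const s
      rw [Measure.map_apply hm hE, hμ0 _ (hm hE), measure_preimage_add_right]
      exact (hμ0 E hE).1 h
    have hmp := measurePreserving_piFinSuccAbove μ 0
    set ν := Measure.pi fun j : Fin d => μ ((0 : Fin (d + 1)).succAbove j) with hν
    have hprod : Measure.QuasiMeasurePreserving (Prod.map (fun t : ℝ => t + s) id)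
        ((μ 0).prod ν) ((μ 0).prod ν) := by
      refine ⟨hq0.measurable.prodMap measurable_id, ?_⟩
      rw [← Measure.map_prod_map _ _ hq0.measurable measurable_id, Measure.map_id]
      exact hq0.absolutelyContinuous.prod Measure.AbsolutelyContinuous.rfl
    have hcomp := ((hmp.symm _).quasiMeasurePreserving.comp hprod).comp hmp.quasiMeasurePreserving
    rw [hρ]
    convert hcomp using 1
    funext α
    funext j
    refine Fin.cases ?_ (fun i => ?_) j <;>
      simp [MeasurableEquiv.piFinSuccAbove, Fin.insertNthEquiv, Fin.tail]
  · rw [heval 0 E hE]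
    exact hμ0 E hE
  · rw [ae_iff]
    simp only [not_not]
    have h1 := heval (Fin.last d) {0} (measurableSet_singleton 0)
    simp only [Set.mem_singleton_iff] at h1
    rw [h1]
    by_cases hs : σ (Fin.last d) = 0
    · have ha := hlast.resolve_left (not_not.2 hs)
      rw [hμ, Measure.map_apply (by fun_prop) (measurableSet_singleton 0)]
      simp [hs, ha]
    · rw [affine_density_apply_eq_zero_iff hD1 _ hs (measurableSet_singleton 0)]
      simp

end CoeffLaw

/-! ### Finite-dimensional laws of the direction process -/

section DirectionProcess

variable {Ω : Type*} {q : ℕ} {a σ : Fin q → ℝ} {η : ℕ → Fin q → Ω → ℝ}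

theorem rowMul_mul (x : EuclideanSpace ℝ (Fin q)) (A B : Matrix (Fin q) (Fin q) ℝ) :
    rowMul x (A * B) = rowMul (rowMul x A) B := by
  simp [rowMul, Matrix.vecMul_vecMul]

theorem rowMul_smul (c : ℝ) (x : EuclideanSpace ℝ (Fin q)) (A : Matrix (Fin q) (Fin q) ℝ) :
    rowMul (c • x) A = c • rowMul x A := by
  simp [rowMul, Matrix.smul_vecMul]

theorem rowMul_eq_norm_smul_dirStep (x : USphere q) (A : Matrix (Fin q) (Fin q) ℝ) :
    rowMul (x : EuclideanSpace ℝ (Fin q)) A = ‖rowMul (x : EuclideanSpace ℝ (Fin q)) A‖ •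
      (dirStep x A : EuclideanSpace ℝ (Fin q)) := by
  by_cases h : rowMul (x : EuclideanSpace ℝ (Fin q)) A = 0
  · simp [h]
  · rw [coe_dirStep_of_ne_zero h, smul_smul, mul_inv_cancel₀ (norm_ne_zero_iff.2 h), one_smul]

/-- The direction process records the direction of `x' A_1 ⋯ A_n`. If the product vanishes, both
sides are zero, whatever the value of the direction process. -/
theorem rowMul_matProd_eq_norm_smul (x : USphere q) (n : ℕ) (ω : Ω) :
    rowMul (x : EuclideanSpace ℝ (Fin q)) (matProd a σ η n ω) =
      ‖rowMul (x : EuclideanSpace ℝ (Fin q)) (matProd a σ η n ω)‖ •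
        (dirProcess a σ η x n ω : EuclideanSpace ℝ (Fin q)) := by
  induction n with
  | zero =>
    have hx : ‖(x : EuclideanSpace ℝ (Fin q))‖ = 1 := mem_sphere_zero_iff_norm.1 x.2
    simp [matProd, dirProcess, rowMul, hx]
  | succ n ih =>
    set c := ‖rowMul (x : EuclideanSpace ℝ (Fin q)) (matProd a σ η n ω)‖ with hc
    have h1 : rowMul (x : EuclideanSpace ℝ (Fin q)) (matProd a σ η (n + 1) ω) =
        c • rowMul (dirProcess a σ η x n ω : EuclideanSpace ℝ (Fin q)) (randMat a σ η n ω) := by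
      rw [matProd, rowMul_mul, ih, rowMul_smul]
    rw [h1, norm_smul, Real.norm_of_nonneg (norm_nonneg _), mul_smul]
    exact congrArg (c • ·) (rowMul_eq_norm_smul_dirStep _ _)

theorem norm_rowMul_matProd_succ (x : USphere q) (n : ℕ) (ω : Ω) :
    ‖rowMul (x : EuclideanSpace ℝ (Fin q)) (matProd a σ η (n + 1) ω)‖ =
      ‖rowMul (x : EuclideanSpace ℝ (Fin q)) (matProd a σ η n ω)‖ *
        ‖rowMul (dirProcess a σ η x n ω : EuclideanSpace ℝ (Fin q)) (randMat a σ η n ω)‖ := by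
  rw [matProd, rowMul_mul]
  conv_lhs => rw [rowMul_matProd_eq_norm_smul]
  rw [rowMul_smul, norm_smul, Real.norm_of_nonneg (norm_nonneg _)]

/-- The density on the first `n` steps of the tilted law relative to `P`, up to the factor
`1 / h x`. -/
noncomputable def pathWeight (a σ : Fin q → ℝ) (η : ℕ → Fin q → Ω → ℝ) (l : ℝ) (h : C(USphere q, ℝ))
    (x : USphere q) (n : ℕ) (ω : Ω) : ℝ :=
  ‖rowMul (x : EuclideanSpace ℝ (Fin q)) (matProd a σ η n ω)‖ ^ l * h (dirProcess a σ η x n ω)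

theorem pathWeight_succ {l : ℝ} {h : C(USphere q, ℝ)} (hpos : ∀ x, 0 < h x) (x : USphere q) (n : ℕ)
    (ω : Ω) : pathWeight a σ η l h x (n + 1) ω =
      pathWeight a σ η l h x n ω * tiltWeight l h (dirProcess a σ η x n ω) (coeff a σ η n ω) := by
  have h0 : h (dirProcess a σ η x n ω) ≠ 0 := (hpos _).ne'
  rw [pathWeight, pathWeight, norm_rowMul_matProd_succ,
    Real.mul_rpow (norm_nonneg _) (norm_nonneg _), tiltWeight]
  simp only [dirProcess, randMat]
  field_simp

/-- The σ-algebra generated by the first `n` random matrices. -/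
abbrev pastSigma (η : ℕ → Fin q → Ω → ℝ) (n : ℕ) : MeasurableSpace Ω :=
  ⨆ p ∈ {p : ℕ × Fin q | p.1 < n}, (inferInstance : MeasurableSpace ℝ).comap (η p.1 p.2)

theorem pastSigma_mono {m n : ℕ} (hmn : m ≤ n) : pastSigma η m ≤ pastSigma η n :=
  biSup_mono fun _ hp => lt_of_lt_of_le hp hmn

theorem measurable_coeff_pastSigma (n : ℕ) : Measurable[pastSigma η (n + 1)] (coeff a σ η n) := by
  refine @measurable_pi_lambda _ _ _ (pastSigma η (n + 1)) _ _ fun i => ?_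
  have h1 : Measurable[pastSigma η (n + 1)] (η n i) := by
    refine Measurable.mono (comap_measurable (η n i)) ?_ le_rfl
    exact le_iSup₂_of_le (f := fun p (_ : p ∈ {p : ℕ × Fin q | p.1 < n + 1}) =>
      (inferInstance : MeasurableSpace ℝ).comap (η p.1 p.2)) (n, i) (Nat.lt_succ_self n) le_rfl
  exact (h1.const_mul (σ i)).const_add (a i)

theorem measurable_dirProcess_pastSigma (x : USphere q) (n : ℕ) :
    Measurable[pastSigma η n] (dirProcess a σ η x n) := by
  induction n with
  | zero => exact @measurable_const _ _ _ (pastSigma η 0) x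
  | succ n ih =>
    have h1 := ih.mono (pastSigma_mono (η := η) (Nat.le_succ n)) le_rfl
    exact measurable_dirStep_companion.comp (h1.prodMk (measurable_coeff_pastSigma n))

theorem measurable_norm_rowMul_matProd_pastSigma (x : USphere q) (n : ℕ) :
    Measurable[pastSigma η n] fun ω =>
      ‖rowMul (x : EuclideanSpace ℝ (Fin q)) (matProd a σ η n ω)‖ := by
  induction n with
  | zero =>
    exact @measurable_const _ _ _ (pastSigma η 0)
      ‖rowMul (x : EuclideanSpace ℝ (Fin q)) (1 : Matrix (Fin q) (Fin q) ℝ)‖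
  | succ n ih =>
    simp only [norm_rowMul_matProd_succ]
    have hle := pastSigma_mono (η := η) (Nat.le_succ n)
    have h1 := (measurable_dirProcess_pastSigma (a := a) (σ := σ) (η := η) x n).mono hle le_rfl
    have h2 : Measurable fun p : USphere q × (Fin q → ℝ) =>
        ‖rowMul (p.1 : EuclideanSpace ℝ (Fin q)) (companion p.2)‖ :=
      measurable_rowMul_companion.norm
    have h3 := h2.comp (h1.prodMk (measurable_coeff_pastSigma (a := a) (σ := σ) n))
    exact (ih.mono hle le_rfl).mul h3

theorem measurable_pathWeight_pastSigma (l : ℝ) (h : C(USphere q, ℝ)) (x : USphere q) (n : ℕ) :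
    Measurable[pastSigma η n] (pathWeight a σ η l h x n) :=
  ((measurable_norm_rowMul_matProd_pastSigma x n).pow_const l).mul
    (h.continuous.measurable.comp (measurable_dirProcess_pastSigma x n))

variable [MeasurableSpace Ω] {P : Measure Ω} {φ : ℝ → ℝ}

theorem pastSigma_le (hD1 : CondD1 P η φ) (n : ℕ) : pastSigma η n ≤ ‹MeasurableSpace Ω› :=
  iSup₂_le fun p _ => (hD1.measurable p.1 p.2).comap_le

/-- The coefficients of the matrix with index `n` are independent of everything that depends on
the previous matrices only. -/
theorem lintegral_past_coeff [IsProbabilityMeasure P] (hD1 : CondD1 P η φ) (n : ℕ) {E : Type*} [MeasurableSpace E] {X : Ω → E}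
    (hX : Measurable[pastSigma η n] X) {H : E × (Fin q → ℝ) → ℝ≥0∞} (hH : Measurable H) :
    ∫⁻ ω, H (X ω, coeff a σ η n ω) ∂P = ∫⁻ ω, ∫⁻ α, H (X ω, α) ∂(coeffLaw P a σ η) ∂P := by
  have hXm : Measurable X := hX.mono (pastSigma_le hD1 n) le_rfl
  set T : Set (ℕ × Fin q) := {p | p.1 = n} with hT
  have hdisj : Disjoint {p : ℕ × Fin q | p.1 < n} T :=
    Set.disjoint_left.2 fun p hp hp' => (show p.1 < n from hp).ne hp'
  have hind := indep_iSup_of_disjoint (fun p : ℕ × Fin q => (hD1.measurable p.1 p.2).comap_le)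
    hD1.indep.iIndep hdisj
  have hcoeff : Measurable[⨆ p ∈ T, (inferInstance : MeasurableSpace ℝ).comap (η p.1 p.2)]
      (coeff a σ η n) := by
    refine @measurable_pi_lambda _ _ _
      (⨆ p ∈ T, (inferInstance : MeasurableSpace ℝ).comap (η p.1 p.2)) _ _ fun i => ?_
    have h1 : Measurable[⨆ p ∈ T, (inferInstance : MeasurableSpace ℝ).comap (η p.1 p.2)]
        (η n i) := by
      refine Measurable.mono (comap_measurable (η n i)) ?_ le_rfl
      exact le_iSup₂_of_le (f := fun p (_ : p ∈ T) =>
        (inferInstance : MeasurableSpace ℝ).comap (η p.1 p.2)) (n, i) rfl le_rfl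
    exact (h1.const_mul (σ i)).const_add (a i)
  have hindep : IndepFun X (coeff a σ η n) P := by
    rw [IndepFun_iff_Indep]
    exact indep_of_indep_of_le_right (indep_of_indep_of_le_left hind hX.comap_le) hcoeff.comap_le
  have hmap := hindep.map_prod_eq_prod_map_map hXm.aemeasurable
    (measurable_coeff hD1 n).aemeasurable
  have h1 : ∫⁻ ω, H (X ω, coeff a σ η n ω) ∂P =
      ∫⁻ p, H p ∂(P.map fun ω => (X ω, coeff a σ η n ω)) :=
    (lintegral_map hH (hXm.prodMk (measurable_coeff hD1 n))).symm
  rw [h1, hmap, map_coeff_eq_coeffLaw hD1, lintegral_prod _ hH.aemeasurable,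
    lintegral_map hH.lintegral_prod_right' hXm]

end DirectionProcess

section FiniteDimensional

variable {Ω : Type*} [MeasurableSpace Ω] {P : Measure Ω} [IsProbabilityMeasure P] {d : ℕ}
  {a σ : Fin (d + 1) → ℝ} {η : ℕ → Fin (d + 1) → Ω → ℝ} {φ : ℝ → ℝ} {l : ℝ}
  {h : C(USphere (d + 1), ℝ)}

theorem lintegral_chainLaw_tiltedKernel (hD1 : CondD1 P η φ) (hpos : ∀ x, 0 < h x)
    [IsMarkovKernel (tiltedKernel (coeffLaw P a σ η) l h)] (x : USphere (d + 1)) (n : ℕ) :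
    ∀ {G : ((_ : Finset.Iic n) → USphere (d + 1)) → ℝ≥0∞}, Measurable G →
      ∫⁻ w, G (Preorder.frestrictLe (π := fun _ => USphere (d + 1)) n w)
        ∂(chainLaw (tiltedKernel (coeffLaw P a σ η) l h) x) =
      ENNReal.ofReal (1 / h x) * ∫⁻ ω, ENNReal.ofReal (pathWeight a σ η l h x n ω) *
        G (fun i => dirProcess a σ η x i ω) ∂P := by
  induction n with
  | zero =>
    intro G hG
    rw [lintegral_chainLaw_zero _ _ hG]
    have hx : ‖(x : EuclideanSpace ℝ (Fin (d + 1)))‖ = 1 := mem_sphere_zero_iff_norm.1 x.2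
    have h1 : ∀ ω, pathWeight a σ η l h x 0 ω = h x := fun ω => by
      simp [pathWeight, matProd, rowMul, dirProcess, hx]
    have h2 : ∀ ω, (fun i : Finset.Iic 0 => dirProcess a σ η x i ω) = fun _ => x := fun ω => by
      funext i
      have : (i : ℕ) = 0 := Nat.le_zero.1 (Finset.mem_Iic.1 i.2)
      rw [this, dirProcess]
    simp only [h1, h2, lintegral_const, measure_univ, mul_one]
    rw [← mul_assoc, ← ENNReal.ofReal_mul (one_div_pos.2 (hpos x)).le,
      one_div_mul_cancel (hpos x).ne', ENNReal.ofReal_one, one_mul]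
  | succ n ih =>
    intro G hG
    set K := tiltedKernel (coeffLaw P a σ η) l h with hK
    -- a path up to time `n + 1` is a path up to time `n` followed by one more state
    set ext : ((_ : Finset.Iic n) → USphere (d + 1)) × USphere (d + 1) → ((_ : Finset.Iic (n + 1)) → USphere (d + 1)) := fun p i =>
      if hi : (i : ℕ) ≤ n then p.1 ⟨i, Finset.mem_Iic.2 hi⟩ else p.2 with hext
    have hextm : Measurable ext := by
      refine measurable_pi_lambda _ fun i => ?_
      simp only [hext]
      split_ifs
      · exact measurable_fst.eval
      · exact measurable_snd
    have hext_eq : ∀ w : ℕ → USphere (d + 1), (fun i : Finset.Iic (n + 1) => w i) =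
        ext ((fun i : Finset.Iic n => w i), w (n + 1)) := by
      intro w
      funext i
      simp only [hext]
      split_ifs with hi
      · rfl
      · have : (i : ℕ) = n + 1 := by have := Finset.mem_Iic.1 i.2; omega
        rw [this]
    have hGe : Measurable fun p => G (ext p) := hG.comp hextm
    have e1 : ∫⁻ w, G (Preorder.frestrictLe (π := fun _ => USphere (d + 1)) (n + 1) w) ∂(chainLaw K x) =
        ∫⁻ w, G (ext (Preorder.frestrictLe (π := fun _ => USphere (d + 1)) n w, w (n + 1))) ∂(chainLaw K x) :=
      lintegral_congr fun w => congrArg G (hext_eq w)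
    rw [e1, lintegral_chainLaw_succ K x n hGe]
    set last : ((_ : Finset.Iic n) → USphere (d + 1)) → USphere (d + 1) := fun v => v ⟨n, Finset.mem_Iic.2 le_rfl⟩ with hlast
    have hlastm : Measurable last := measurable_pi_apply _
    have hG2 : Measurable fun v : (_ : Finset.Iic n) → USphere (d + 1) => ∫⁻ y, G (ext (v, y)) ∂(K (last v)) :=
      Measurable.lintegral_kernel_prod_right' (κ := K.comap last hlastm) hGe
    have e2 := ih hG2
    refine e2.trans (congrArg (ENNReal.ofReal (1 / h x) * ·) ?_)
    -- integrate out the coefficients with index `n`, which are independent of the past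
    set X : Ω → ℝ × ((_ : Finset.Iic n) → USphere (d + 1)) := fun ω =>
      (pathWeight a σ η l h x n ω, fun i => dirProcess a σ η x i ω) with hX
    have hXm : Measurable[pastSigma η n] X := by
      refine (measurable_pathWeight_pastSigma l h x n).prodMk ?_
      refine @measurable_pi_lambda _ _ _ (pastSigma η n) _ _ fun i => ?_
      exact (measurable_dirProcess_pastSigma x i).mono
        (pastSigma_mono (Finset.mem_Iic.1 i.2)) le_rfl
    set H : (ℝ × ((_ : Finset.Iic n) → USphere (d + 1))) × (Fin (d + 1) → ℝ) → ℝ≥0∞ := fun p =>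
      ENNReal.ofReal p.1.1 * (ENNReal.ofReal (tiltWeight l h (last p.1.2) p.2) *
        G (ext (p.1.2, dirStep (last p.1.2) (companion p.2)))) with hH
    have hHm : Measurable H := by
      have m1 : Measurable fun p : (ℝ × ((_ : Finset.Iic n) → USphere (d + 1))) ×
          (Fin (d + 1) → ℝ) => last p.1.2 := hlastm.comp (measurable_snd.comp measurable_fst)
      have m2 := m1.tiltWeight (l := l) (h := h) measurable_snd
      have m3 := m1.dirStep_companion measurable_snd
      have m4 : Measurable fun p : (ℝ × ((_ : Finset.Iic n) → USphere (d + 1))) × (Fin (d + 1) → ℝ) =>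
          G (ext (p.1.2, dirStep (last p.1.2) (companion p.2))) :=
        hGe.comp ((measurable_snd.comp measurable_fst).prodMk m3)
      exact (measurable_fst.comp measurable_fst).ennreal_ofReal.mul (m2.ennreal_ofReal.mul m4)
    have e3 := lintegral_past_coeff (a := a) (σ := σ) hD1 n hXm hHm
    have e4 : ∀ ω, ∫⁻ α, H (X ω, α) ∂(coeffLaw P a σ η) =
        ENNReal.ofReal (pathWeight a σ η l h x n ω) *
          ∫⁻ y, G (ext ((fun i => dirProcess a σ η x i ω), y)) ∂(K (dirProcess a σ η x n ω)) := by
      intro ω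
      have m5 : Measurable fun y => G (ext ((fun i => dirProcess a σ η x i ω), y)) :=
        hGe.comp measurable_prodMk_left
      rw [hK, lintegral_tiltedKernel _ m5, ← lintegral_const_mul]
      · exact (measurable_tiltWeight_right _).ennreal_ofReal.mul
          (m5.comp (measurable_dirStep_right _))
    have e5 : ∀ ω, H (X ω, coeff a σ η n ω) =
        ENNReal.ofReal (pathWeight a σ η l h x (n + 1) ω) *
          G (fun i => dirProcess a σ η x i ω) := by
      intro ω
      have hw : 0 ≤ pathWeight a σ η l h x n ω :=
        mul_nonneg (Real.rpow_nonneg (norm_nonneg _) _) (hpos _).le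
      rw [pathWeight_succ hpos, ENNReal.ofReal_mul hw, mul_assoc,
        hext_eq fun i => dirProcess a σ η x i ω]
      rfl
    rw [← lintegral_congr e5, e3]
    exact lintegral_congr fun ω => (e4 ω).symm

end FiniteDimensional

/-! ### The direction chain and its tilted version -/

section Conclusion

theorem measure_ext_of_map_frestrictLe {S : Type*} [MeasurableSpace S] {μ ν : Measure (ℕ → S)}
    [IsFiniteMeasure μ] [IsFiniteMeasure ν]
    (h : ∀ n, μ.map (Preorder.frestrictLe (π := fun _ => S) n) =
      ν.map (Preorder.frestrictLe (π := fun _ => S) n)) : μ = ν := by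
  refine IsProjectiveLimit.unique (P := fun I : Finset ℕ => ν.map (I.restrict (π := fun _ => S)))
    (fun I => ?_) fun I => rfl
  have hI : I ⊆ Finset.Iic (I.sup id) := fun i hi => Finset.mem_Iic.2 (Finset.le_sup (f := id) hi)
  have e : I.restrict (π := fun _ => S) = Finset.restrict₂ (π := fun _ => S) hI ∘
      Preorder.frestrictLe (π := fun _ => S) (I.sup id) := rfl
  have m1 : Measurable (Finset.restrict₂ (π := fun _ => S) hI) := Finset.measurable_restrict₂ hI
  have m2 : Measurable (Preorder.frestrictLe (π := fun _ => S) (I.sup id)) :=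
    Preorder.measurable_frestrictLe _
  show μ.map (I.restrict (π := fun _ => S)) = ν.map (I.restrict (π := fun _ => S))
  rw [e, ← Measure.map_map m1 m2, ← Measure.map_map m1 m2, h]

variable {Ω : Type*} [MeasurableSpace Ω] {P : Measure Ω} {d : ℕ} {a σ : Fin (d + 1) → ℝ}
  {η : ℕ → Fin (d + 1) → Ω → ℝ} {φ : ℝ → ℝ}

/-- The direction kernel is the tilted kernel with exponent `0` and constant eigenfunction. -/
theorem directionKernel_eq_tiltedKernel (ρ : Measure (Fin (d + 1) → ℝ)) [SFinite ρ] :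
    directionKernel ρ = tiltedKernel ρ 0 1 := by
  ext1 x
  have h1 : (fun α => ENNReal.ofReal (tiltWeight 0 (1 : C(USphere (d + 1), ℝ)) x α)) = 1 := by
    funext α
    simp [tiltWeight]
  rw [tiltedKernel_apply, h1, withDensity_one]
  rfl

theorem integral_tiltWeight_eq_one (hD1 : CondD1 P η φ) {l : ℝ} {h : C(USphere (d + 1), ℝ)}
    (hpos : ∀ x, 0 < h x) (heig : ∀ x, transferOp P a σ η l h x = h x) (x : USphere (d + 1)) :
    ∫ α, tiltWeight l h x α ∂(coeffLaw P a σ η) = 1 := by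
  rw [coeffLaw, integral_map (measurable_coeff hD1 0).aemeasurable
    (measurable_tiltWeight_right x).aestronglyMeasurable]
  have h1 : ∫ ω, tiltWeight l h x (coeff a σ η 0 ω) ∂P = transferOp P a σ η l h x / h x := by
    rw [transferOp, ← integral_div]
    rfl
  rw [h1, heig, div_self (hpos x).ne']

theorem map_dirProcess_eq_chainLaw [IsProbabilityMeasure P] (hD1 : CondD1 P η φ)
    [IsMarkovKernel (tiltedKernel (coeffLaw P a σ η) 0 1)] (x : USphere (d + 1)) :
    P.map (fun ω n => dirProcess a σ η x n ω) =
      chainLaw (tiltedKernel (coeffLaw P a σ η) 0 1) x := by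
  have hm : Measurable fun ω n => dirProcess a σ η x n ω := measurable_pi_lambda _ fun n =>
    (measurable_dirProcess_pastSigma x n).mono (pastSigma_le hD1 n) le_rfl
  have hprob : IsProbabilityMeasure (P.map fun ω n => dirProcess a σ η x n ω) :=
    Measure.isProbabilityMeasure_map hm.aemeasurable
  refine measure_ext_of_map_frestrictLe fun n => Measure.ext_of_lintegral _ fun G hG => ?_
  have mr : Measurable (Preorder.frestrictLe (π := fun _ => USphere (d + 1)) n) :=
    Preorder.measurable_frestrictLe _
  have hGm : Measurable fun w : ℕ → USphere (d + 1) =>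
      G (Preorder.frestrictLe (π := fun _ => USphere (d + 1)) n w) := hG.comp mr
  rw [lintegral_map hG mr, lintegral_map hGm hm, lintegral_map hG mr,
    lintegral_chainLaw_tiltedKernel hD1 (fun x => by simp) x n hG]
  simp only [pathWeight, Real.rpow_zero, one_mul, ContinuousMap.one_apply, div_one,
    ENNReal.ofReal_one]
  rfl

end Conclusion

/-- The condition on the even moments forces `σ 0 ≠ 0`: otherwise the moment of order `2 m` would
be `0`, or `1` for `m = 0`. -/
theorem isSpreadRow_of_conditions {Ω : Type*} [MeasurableSpace Ω] {P : Measure Ω}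
    [IsProbabilityMeasure P] {d : ℕ} {a σ : Fin (d + 1) → ℝ} {η : ℕ → Fin (d + 1) → Ω → ℝ}
    {φ : ℝ → ℝ} (hD1 : CondD1 P η φ) (hD2 : CondD2 P a σ η 0)
    (hlast : 0 < a (Fin.last d) ^ 2 + σ (Fin.last d) ^ 2) : IsSpreadRow (coeffLaw P a σ η) := by
  refine isSpreadRow_coeffLaw hD1 ?_ ?_
  · intro h0
    obtain ⟨m, -, hm⟩ := hD2
    refine absurd hm (not_lt.2 ?_)
    rcases Nat.eq_zero_or_pos m with rfl | hm0
    · simp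
    · have h2 : 2 * m ≠ 0 := by omega
      simp [coeff, h0, h2]
  · by_contra hcon
    push Not at hcon
    rw [hcon.1, hcon.2] at hlast
    simp at hlast

theorem lemmaA9 {Ω : Type*} [MeasurableSpace Ω] (P : Measure Ω) [IsProbabilityMeasure P]
    (q : ℕ) (hq : 2 ≤ q) (a σ : Fin q → ℝ) (η : ℕ → Fin q → Ω → ℝ) (φ : ℝ → ℝ)
    (hmodel : ModelNormalised P σ η)
    (hD1 : CondD1 P η φ)
    (hD2 : CondD2 P a σ η ⟨0, by omega⟩)
    (hlast : 0 < a ⟨q - 1, by omega⟩ ^ 2 + σ ⟨q - 1, by omega⟩ ^ 2) :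
    -- the direction chain under `P`
    (∃ _ : IsMarkovKernel (directionKernel (coeffLaw P a σ η)),
      (∀ x : USphere q, P.map (fun ω n => dirProcess a σ η x n ω) =
        chainLaw (directionKernel (coeffLaw P a σ η)) x) ∧
      IsPositiveHarrisRecurrent (directionKernel (coeffLaw P a σ η)) ∧
      ∃ π : Measure (USphere q), IsProbabilityMeasure π ∧
        Kernel.Invariant (directionKernel (coeffLaw P a σ η)) π ∧
        IsUniformlyGeometricallyErgodic (directionKernel (coeffLaw P a σ η)) π ∧
        π ≪ sphereLebesgue q ∧ sphereLebesgue q ≪ π) ∧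
    -- the direction chain under the tilted measures
    (∀ (l : ℝ) (h : C(USphere q, ℝ)), 0 < l → IsKappa P a σ η l 1 → (∀ x, 0 < h x) →
      (∀ x, transferOp P a σ η l h x = h x) →
      ∃ _ : IsMarkovKernel (tiltedKernel (coeffLaw P a σ η) l h),
        (∀ (x : USphere q) (n : ℕ) (F : (Fin n → USphere q) → ℝ≥0∞), Measurable F →
          ∫⁻ w, F (fun i => w (i + 1)) ∂(chainLaw (tiltedKernel (coeffLaw P a σ η) l h) x) =
            ENNReal.ofReal (1 / h x) *
              ∫⁻ ω, ENNReal.ofReal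
                  (‖rowMul (x : EuclideanSpace ℝ (Fin q)) (matProd a σ η n ω)‖ ^ l *
                    h (dirProcess a σ η x n ω)) *
                F (fun i => dirProcess a σ η x (i + 1) ω) ∂P) ∧
        IsPositiveHarrisRecurrent (tiltedKernel (coeffLaw P a σ η) l h) ∧
        ∃ π : Measure (USphere q), IsProbabilityMeasure π ∧
          Kernel.Invariant (tiltedKernel (coeffLaw P a σ η) l h) π ∧
          IsUniformlyGeometricallyErgodic (tiltedKernel (coeffLaw P a σ η) l h) π ∧
          π ≪ sphereLebesgue q ∧ sphereLebesgue q ≪ π) := by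
  obtain ⟨d, rfl⟩ : ∃ d, q = d + 1 := ⟨q - 1, by omega⟩
  have hprob : IsProbabilityMeasure (coeffLaw P a σ η) := isProbabilityMeasure_coeffLaw hD1
  have hρ : IsSpreadRow (coeffLaw P a σ η) := isSpreadRow_of_conditions hD1 hD2 hlast
  have hmom := integrable_abs_pow_coeffLaw (a := a) (σ := σ) hD1
  refine ⟨?_, fun l h hl _ hpos heig => ?_⟩
  · have hone : ∀ x, (0 : ℝ) < (1 : C(USphere (d + 1), ℝ)) x := fun x => by simp
    have hK : IsMarkovKernel (tiltedKernel (coeffLaw P a σ η) 0 1) :=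
      isMarkovKernel_tiltedKernel le_rfl hone hmom fun x => by simp [tiltWeight]
    simp only [directionKernel_eq_tiltedKernel]
    exact ⟨hK, map_dirProcess_eq_chainLaw hD1, tiltedKernel_ergodic hρ le_rfl hone hmom⟩
  · have hK : IsMarkovKernel (tiltedKernel (coeffLaw P a σ η) l h) :=
      isMarkovKernel_tiltedKernel hl.le hpos hmom (integral_tiltWeight_eq_one hD1 hpos heig)
    refine ⟨hK, fun x n F hF => ?_, tiltedKernel_ergodic hρ hl.le hpos hmom⟩
    have hG : Measurable fun v : (_ : Finset.Iic n) → USphere (d + 1) =>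
        F fun i : Fin n => v ⟨i + 1, Finset.mem_Iic.2 i.2⟩ :=
      hF.comp (measurable_pi_lambda _ fun i => measurable_pi_apply _)
    exact lintegral_chainLaw_tiltedKernel hD1 hpos x n hG
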